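/- \textbf{Setting.} Let $n\ge 2$, let $\xi$ have law $\mathcal P$, let $f(\cdot;\xi):\mathbb R^n\to\mathbb R$ be twice differentiable for every $\xi$ (and $f$ jointly measurable, $f(x;\cdot)$ integrable for every $x$), and let $F(x)=\mathbb E_\xi[f(x;\xi)]$ be bounded below, $F^*=\inf F$, $\Delta_F=F(x_0)-F^*$. Norms are Euclidean for vectors and spectral for matrices. Assume, for constants $L_0,M_0,\delta,C_0,C_1>0$ and $L_1,M_1,G_0,G_1,K_0,K_1\ge 0$: (1) $F$ is differentiable and $\|\nabla F(x)-\nabla F(x')\|\le (L_0+L_1\|\nabla F(x)\|)\|x-x'\|$ whenever $L_1\|x-x'\|\le 1$; (2) $\mathbb E_\xi[\nabla f(x;\xi)]=\nabla F(x)$ and $\mathbb E_\xi\|\nabla f(x;\xi)-\nabla F(x)\|^2\le G_0^2+G_1^2\|\nabla F(x)\|^2$ for all $x$; (3) $F$ is twice differentiable, $\|\nabla^2F(x)-\nabla^2F(x')\|\le (M_0+M_1\|\nabla F(x)\|)\|x-x'\|$ whenever $\|x-x'\|\le\delta$, $\mathbb E_\xi[\nabla^2 f(x;\xi)]=\nabla^2F(x)$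 and $\mathbb E_\xi\|\nabla^2 f(x;\xi)-\nabla^2F(x)\|^2\le K_0^2+K_1^2\|\nabla F(x)\|^2$ for all $x$. \textbf{Method.} Starting from a fixed point $x_0$, for $t=0,\dots,T-1$: draw independent samples from $\mathcal P$, independent of everything before iteration $t$, forming batches $\mathcal S_1,\mathcal S_2$; put $g_t=\nabla f(x_t;\mathcal S_1)$, $H_t=\nabla^2 f(x_t;\mathcal S_2)$, where $f(x;\mathcal S)=|\mathcal S|^{-1}\sum_{\xi\in\mathcal S}f(x;\xi)$; choose a (possibly random) $V_t\in\mathbb R^{n\times k}$ with $V_t^TV_t=I$; put $B_t=V_tV_t^TH_tV_tV_t^T$; let $d_{t+1}$ be a global minimizer of $F(x_t)+g_t^Td+\frac12 d^TB_td$ over $\|d\|\le\sqrt\epsilon$; set $x_{t+1}=x_t+d_{t+1}$. Assume (4) almost surely, for all $t<T$, $\|(\nabla^2F(x_t)-V_tV_t^T\nabla^2F(x_t)V_tV_t^T)d_{t+1}\|\le (C_0+C_1\|\nabla F(x_t)\|)\|d_{t+1}\|^2$. \textbf{Theorem.} For all $D\in\mathbb R$ and $0<a\le b$ there is a constant $C>0$,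 depending only on $L_0,L_1,G_0,G_1,\delta,M_0,M_1,K_0,K_1,C_0,C_1,D,a,b$, such that the following holds for every problem and every run as above with $\Delta_F\le D$. If $$0<\epsilon<\min\Big\{\frac{3}{5M_1+18G_1+24K_1+6C_1},\ \frac1{L_1^2}\Big\}$$ (with $1/L_1^2=\infty$ if $L_1=0$), $|\mathcal S_1|=\lceil\epsilon^{-2}\rceil$, $|\mathcal S_2|=\lceil 22\log(n)\,\epsilon^{-1}\rceil$ and $a\,\epsilon^{-3/2}\le T\le b\,\epsilon^{-3/2}$, and if $\bar t$ is uniform on $\{0,\dots,T-1\}$ and independent of the run, then $$\mathbb E\big[\|\nabla F(x_{\bar t+1})\|\big]\le C\epsilon,\qquad \mathbb E\big[\lambda_{\min}\big(V_{\bar t}V_{\bar t}^T\,\nabla^2F(x_{\bar t+1})\,V_{\bar t}V_{\bar t}^T\big)\big]\ge -C\sqrt\epsilon ,$$ both expectations being well defined and finite. -/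

import Mathlib

open MeasureTheory ProbabilityTheory

noncomputable section

namespace TrustRegion

/-- `ℝⁿ` with the Euclidean norm. -/
abbrev Vec (n : ℕ) : Type := EuclideanSpace ℝ (Fin n)

variable {n k : ℕ} {Ξ Ω : Type*}

/-- The Hessian `∇²F(x)`, as a linear operator on `ℝⁿ`; its operator norm is the spectral norm. -/
def hess (F : Vec n → ℝ) (x : Vec n) : Vec n →L[ℝ] Vec n :=
  fderiv ℝ (gradient F) x

/-- Smallest eigenvalue of a symmetric operator. -/
def lambdaMin (A : Vec n →L[ℝ] Vec n) : ℝ := sInf (spectrum ℝ A)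

/-- The function is twice differentiable on `ℝⁿ`. -/
def TwiceDifferentiable (F : Vec n → ℝ) : Prop :=
  Differentiable ℝ F ∧ Differentiable ℝ (gradient F)

/-- The objective `F(x) = E_ξ f(x; ξ)`. -/
def objective [MeasurableSpace Ξ] (P : Measure Ξ) (f : Vec n → Ξ → ℝ) (x : Vec n) : ℝ :=
  ∫ ξ, f x ξ ∂P

/-- `(L₀, L₁)`-smoothness. The condition `‖x - x'‖ ≤ 1 / L₁` is void for `L₁ = 0`. -/
def GeneralizedSmooth (F : Vec n → ℝ) (L₀ L₁ : ℝ) : Prop :=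
  Differentiable ℝ F ∧ ∀ x x' : Vec n, L₁ * ‖x - x'‖ ≤ 1 →
    ‖gradient F x - gradient F x'‖ ≤ (L₀ + L₁ * ‖gradient F x‖) * ‖x - x'‖

/-- The stochastic gradient is unbiased with `(G₀, G₁)`-bounded variance. -/
def BoundedGradientVariance [MeasurableSpace Ξ] (P : Measure Ξ) (f : Vec n → Ξ → ℝ)
    (G₀ G₁ : ℝ) : Prop :=
  ∀ x : Vec n,
    Integrable (fun ξ => gradient (fun y => f y ξ) x) P ∧
    ∫ ξ, gradient (fun y => f y ξ) x ∂P = gradient (objective P f) x ∧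
    Integrable (fun ξ => ‖gradient (fun y => f y ξ) x - gradient (objective P f) x‖ ^ 2) P ∧
    ∫ ξ, ‖gradient (fun y => f y ξ) x - gradient (objective P f) x‖ ^ 2 ∂P
      ≤ G₀ ^ 2 + G₁ ^ 2 * ‖gradient (objective P f) x‖ ^ 2

/-- Second-order generalized smoothness. -/
def SecondOrderSmooth (F : Vec n → ℝ) (δ M₀ M₁ : ℝ) : Prop :=
  TwiceDifferentiable F ∧ ∀ x x' : Vec n, ‖x - x'‖ ≤ δ →
    ‖hess F x - hess F x'‖ ≤ (M₀ + M₁ * ‖gradient F x‖) * ‖x - x'‖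

/-- The stochastic Hessian is unbiased with `(K₀, K₁)`-bounded variance. -/
def BoundedHessianVariance [MeasurableSpace Ξ] (P : Measure Ξ) (f : Vec n → Ξ → ℝ)
    (K₀ K₁ : ℝ) : Prop :=
  ∀ x : Vec n,
    Integrable (fun ξ => hess (fun y => f y ξ) x) P ∧
    ∫ ξ, hess (fun y => f y ξ) x ∂P = hess (objective P f) x ∧
    Integrable (fun ξ => ‖hess (fun y => f y ξ) x - hess (objective P f) x‖ ^ 2) P ∧
    ∫ ξ, ‖hess (fun y => f y ξ) x - hess (objective P f) x‖ ^ 2 ∂P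
      ≤ K₀ ^ 2 + K₁ ^ 2 * ‖gradient (objective P f) x‖ ^ 2

/-- The batch function `f(x; S) = |S|⁻¹ ∑_{ξ ∈ S} f(x; ξ)` of a batch `S` of `m` samples. -/
def batch {m : ℕ} (f : Vec n → Ξ → ℝ) (S : Fin m → Ξ) (x : Vec n) : ℝ :=
  (m : ℝ)⁻¹ * ∑ i, f x (S i)

/-- The operator `V Vᵀ`. -/
def proj (V : Matrix (Fin n) (Fin k) ℝ) : Vec n →L[ℝ] Vec n :=
  Matrix.toEuclideanCLM (𝕜 := ℝ) (V * V.transpose)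

/-- The projected operator `V Vᵀ A V Vᵀ`. -/
def projected (V : Matrix (Fin n) (Fin k) ℝ) (A : Vec n →L[ℝ] Vec n) : Vec n →L[ℝ] Vec n :=
  proj V ∘L A ∘L proj V

/-- The quadratic model `c + gᵀ d + dᵀ B d / 2`. -/
def model (c : ℝ) (g : Vec n) (B : Vec n →L[ℝ] Vec n) (d : Vec n) : ℝ :=
  c + inner ℝ g d + (1 / 2) * inner ℝ d (B d)

/-- `d` is a global solution of the trust region subproblem: it minimizes the model over
`‖d‖ ≤ Δ`. -/
def SolvesSubproblem (c : ℝ) (g : Vec n) (B : Vec n →L[ℝ] Vec n) (Δ : ℝ) (d : Vec n) : Prop :=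
  ‖d‖ ≤ Δ ∧ ∀ e : Vec n, ‖e‖ ≤ Δ → model c g B d ≤ model c g B e

/-- A run of `T` iterations of the trust region method with projected Hessian estimates, started
at `x₀`, with constant radius `Δ` and batch sizes `m₁`, `m₂`. Here `x t` is the iterate, `d (t + 1)`
the step, `S₁ t` and `S₂ t` the batches and `V t` the basis matrix of iteration `t`; `ℱ t` carries
the randomness before iteration `t`. The basis `V t` may depend on everything known by
the end of iteration `t`, and on extra randomness. -/
structure IsRun [MeasurableSpace Ξ] [mΩ : MeasurableSpace Ω] (P : Measure Ξ) (f : Vec n → Ξ → ℝ)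
    (μ : Measure Ω) (ℱ : Filtration ℕ mΩ) (x₀ : Vec n) (Δ : ℝ) (T m₁ m₂ : ℕ)
    (S₁ : ℕ → Fin m₁ → Ω → Ξ) (S₂ : ℕ → Fin m₂ → Ω → Ξ)
    (V : ℕ → Ω → Matrix (Fin n) (Fin k) ℝ) (x d : ℕ → Ω → Vec n) : Prop where
  /-- the run starts at `x₀` -/
  start : ∀ ω, x 0 ω = x₀
  /-- the iterates, samples and bases are part of the history -/
  iterate_meas : ∀ t ≤ T, Measurable[ℱ t] (x t)
  sample₁_meas : ∀ t < T, ∀ i, Measurable[ℱ (t + 1)] (S₁ t i)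
  sample₂_meas : ∀ t < T, ∀ j, Measurable[ℱ (t + 1)] (S₂ t j)
  basis_meas : ∀ t < T, ∀ i j, Measurable[ℱ (t + 1)] (fun ω => V t ω i j)
  /-- the samples have law `P` -/
  sample₁_law : ∀ t < T, ∀ i, μ.map (S₁ t i) = P
  sample₂_law : ∀ t < T, ∀ j, μ.map (S₂ t j) = P
  /-- the samples of one iteration are mutually independent -/
  sample_indep : ∀ t < T,
    iIndepFun (β := fun _ : Fin m₁ ⊕ Fin m₂ => Ξ) (fun i => Sum.elim (S₁ t) (S₂ t) i) μ
  /-- the samples of iteration `t` are jointly independent of everything before -/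
  sample_fresh : ∀ t < T,
    Indep (MeasurableSpace.comap
      (fun ω => ((fun i => S₁ t i ω, fun j => S₂ t j ω) : (Fin m₁ → Ξ) × (Fin m₂ → Ξ)))
      inferInstance) (ℱ t) μ
  /-- the columns of `V t` are orthonormal -/
  basis_orthonormal : ∀ t < T, ∀ ω, (V t ω).transpose * V t ω = 1
  /-- the step solves the subproblem with `g_t = ∇f(x_t; S₁)` and
  `B_t = V_t V_tᵀ H_t V_t V_tᵀ`, where `H_t = ∇²f(x_t; S₂)` -/
  step : ∀ t < T, ∀ ω,
    SolvesSubproblem (objective P f (x t ω))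
      (gradient (batch f (fun i => S₁ t i ω)) (x t ω))
      (projected (V t ω) (hess (batch f (fun j => S₂ t j ω)) (x t ω)))
      Δ (d (t + 1) ω)
  update : ∀ t < T, ∀ ω, x (t + 1) ω = x t ω + d (t + 1) ω

/-- The inexactness condition on the subspaces: almost surely, for every `t < T`,
`‖(∇²F(x_t) - V_t V_tᵀ ∇²F(x_t) V_t V_tᵀ) d_{t+1}‖ ≤ (C₀ + C₁ ‖∇F(x_t)‖) ‖d_{t+1}‖²`. -/
def SubspaceInexactness [MeasurableSpace Ω] (F : Vec n → ℝ) (μ : Measure Ω) (T : ℕ)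
    (V : ℕ → Ω → Matrix (Fin n) (Fin k) ℝ) (x d : ℕ → Ω → Vec n) (C₀ C₁ : ℝ) : Prop :=
  ∀ t < T, ∀ᵐ ω ∂μ,
    ‖(hess F (x t ω) - projected (V t ω) (hess F (x t ω))) (d (t + 1) ω)‖
      ≤ (C₀ + C₁ * ‖gradient F (x t ω)‖) * ‖d (t + 1) ω‖ ^ 2

/-- Joint law of an index `t̄` uniform on `{0, …, T - 1}` and, independently of it, the run. -/
def withUniformIndex [MeasurableSpace Ω] (T : ℕ) (μ : Measure Ω) : Measure (ℕ × Ω) :=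
  (uniformOn (Set.Iio T)).prod μ

end TrustRegion

end

/-! ### Trace powers and a smooth substitute for the squared spectral norm. -/

section TracePotential

variable {E : Type*} [NormedAddCommGroup E] [InnerProductSpace ℝ E] [FiniteDimensional ℝ E]

/-! Write `Δ = √ε`. The optimality conditions of the trust region subproblem supply a multiplier
`lam ≥ 0` with `g + B d = -lam d`, `lam ‖d‖ = lam Δ` and `B + lam ≥ 0`. Up to errors, the step
lowers `F` by at least `lam Δ² / 2`, while the new gradient has norm at most `lam Δ` and the new
projected Hessian is at least `-lam`. Hence `Δ ‖∇F(x⁺)‖ / 2` and `-Δ² λ_min / 2` are both bounded by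
the decrease of `F` plus errors (`step_decrease`).

The errors are `Δ` times the gradient error, `Δ²` times the Hessian error, and `Δ³` times a Taylor
and subspace term. The batch sizes make each of order `Δ³ (1 + ‖∇F(x_t)‖)` in expectation. For
gradients this is additivity of variance in a Hilbert space. For Hessians a bound independent of the
dimension requires a batch of order `log n / ε`: the squared spectral norm is replaced by
`tracePotential`, a smoothed squared Schatten norm of order about `2 log n`, which dominates it and
has quadratic growth with constant `O(log n)` (`tracePotential_add_le`,
`lintegral_opNorm_batch_sub_le`).

Summed over the run, the decreases telescope to at most `D`, and `T Δ³` lies between `a` and `b`.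
The error terms proportional to `‖∇F(x_t)‖` are absorbed into the left side when `ε` is small;
shifting the index by one costs `‖∇F(x₀)‖`, which is bounded in terms of `D`
(`GeneralizedSmooth.norm_gradient_le`). Division by `T` gives the rates `Δ² = ε` and `Δ`
(`average_bounds`).

When `ε` exceeds a threshold depending only on the constants, `T` is bounded and the gradient norm,
plus a constant, at most doubles per step. All quantities are then bounded deterministically and a
large `C` suffices. -/

/-- The trace of an operator, as a continuous linear functional. -/
noncomputable def opTrace (E : Type*) [NormedAddCommGroup E] [InnerProductSpace ℝ E]
    [FiniteDimensional ℝ E] : (E →L[ℝ] E) →L[ℝ] ℝ :=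
  LinearMap.toContinuousLinearMap (LinearMap.trace ℝ E ∘ₗ ContinuousLinearMap.coeLM ℝ)

theorem opTrace_eq_sum_inner {ι : Type*} [Fintype ι] (b : OrthonormalBasis ι ℝ E)
    (A : E →L[ℝ] E) : opTrace E A = ∑ i, inner ℝ (b i) (A (b i)) :=
  LinearMap.trace_eq_sum_inner (A : E →ₗ[ℝ] E) b

theorem opTrace_mul_comm (A B : E →L[ℝ] E) : opTrace E (A * B) = opTrace E (B * A) :=
  LinearMap.trace_mul_comm ℝ (A : E →ₗ[ℝ] E) (B : E →ₗ[ℝ] E)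

theorem exists_orthonormal_eigenbasis {A : E →L[ℝ] E} (hA : IsSelfAdjoint A) :
    ∃ (b : OrthonormalBasis (Fin (Module.finrank ℝ E)) ℝ E) (l : Fin (Module.finrank ℝ E) → ℝ),
      ∀ j i, (A ^ j) (b i) = l i ^ j • b i := by
  have hs := ContinuousLinearMap.isSelfAdjoint_iff_isSymmetric.1 hA
  refine ⟨hs.eigenvectorBasis rfl, hs.eigenvalues rfl, fun j i => ?_⟩
  induction j with
  | zero => simp
  | succ j ih =>
    have h1 := hs.apply_eigenvectorBasis rfl i
    simp only [ContinuousLinearMap.coe_coe, RCLike.ofReal_real_eq_id, id_eq] at h1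
    rw [pow_succ, mul_apply_eq_comp, h1, map_smul, ih, smul_smul, pow_succ, mul_comm]

theorem opTrace_pow_eq_sum {ι : Type*} [Fintype ι] {A : E →L[ℝ] E} (b : OrthonormalBasis ι ℝ E)
    (l : ι → ℝ) (hb : ∀ j i, (A ^ j) (b i) = l i ^ j • b i) (j : ℕ) :
    opTrace E (A ^ j) = ∑ i, l i ^ j := by
  rw [opTrace_eq_sum_inner b]
  refine Finset.sum_congr rfl fun i _ => ?_
  rw [hb, inner_smul_right, real_inner_self_eq_norm_sq, b.norm_eq_one]
  ring

/-- In an eigenbasis of `A` the trace is `∑ l_a^j l_c^k X_ca²`. Symmetrizing in `j` and `k` and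
comparing with `l_a^(2r) + l_c^(2r)` leaves row sums `∑_c X_ca² = ‖X b_a‖² ≤ ‖X‖²`. -/
theorem opTrace_pow_mul_pow_mul_le {A X : E →L[ℝ] E} (hA : IsSelfAdjoint A)
    (hX : IsSelfAdjoint X) {j k r : ℕ} (hjk : j + k = 2 * r) :
    opTrace E (A ^ j * X * A ^ k * X) ≤ ‖X‖ ^ 2 * opTrace E (A ^ (2 * r)) := by
  obtain ⟨b, l, hb⟩ := exists_orthonormal_eigenbasis hA
  have hXs := ContinuousLinearMap.isSelfAdjoint_iff_isSymmetric.1 hX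
  have key : ∀ j k : ℕ, opTrace E (A ^ j * X * A ^ k * X)
      = ∑ a, ∑ c, l a ^ j * l c ^ k * inner ℝ (b c) (X (b a)) ^ 2 := by
    intro j k
    rw [opTrace_eq_sum_inner b]
    refine Finset.sum_congr rfl fun a _ => ?_
    have hAj := ContinuousLinearMap.isSelfAdjoint_iff_isSymmetric.1 (hA.pow j)
    have e1 : inner ℝ (b a) ((A ^ j * X * A ^ k * X) (b a))
        = l a ^ j * inner ℝ (X (b a)) ((A ^ k) (X (b a))) := by
      have h1 := hAj (b a) ((X * A ^ k * X) (b a))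
      have h2 := hXs (b a) ((A ^ k * X) (b a))
      simp only [ContinuousLinearMap.coe_coe, mul_apply_eq_comp] at h1 h2
      simp only [mul_apply_eq_comp]
      rw [← h1, hb, inner_smul_left, ← h2]
      simp
    rw [e1]
    have e2 : (A ^ k) (X (b a)) = ∑ c, (inner ℝ (b c) (X (b a)) * l c ^ k) • b c := by
      conv_lhs => rw [← b.sum_repr' (X (b a))]
      rw [map_sum]
      refine Finset.sum_congr rfl fun c _ => ?_
      rw [map_smul, hb, smul_smul]
    rw [e2, inner_sum, Finset.mul_sum]
    refine Finset.sum_congr rfl fun c _ => ?_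
    rw [inner_smul_right, real_inner_comm]
    ring
  have hcomm : opTrace E (A ^ j * X * A ^ k * X) = opTrace E (A ^ k * X * A ^ j * X) := by
    rw [mul_assoc (A ^ j * X), opTrace_mul_comm, ← mul_assoc]
  -- With absolute values this is the rearrangement inequality: `|l a|^j - |l c|^j` and `|l a|^k -
  -- |l c|^k` have the same sign.
  have hpt : ∀ a c, l a ^ j * l c ^ k + l a ^ k * l c ^ j ≤ l a ^ (2 * r) + l c ^ (2 * r) := by
    intro a c
    have h0 : ∀ j k : ℕ, l a ^ j * l c ^ k ≤ |l a| ^ j * |l c| ^ k := fun j k => by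
      rw [← abs_pow, ← abs_pow, ← abs_mul]; exact le_abs_self _
    have h1 : 0 ≤ (|l a| ^ j - |l c| ^ j) * (|l a| ^ k - |l c| ^ k) := by
      rcases le_total (|l a|) (|l c|) with h | h
      · exact mul_nonneg_of_nonpos_of_nonpos
          (sub_nonpos.2 (pow_le_pow_left₀ (abs_nonneg _) h _))
          (sub_nonpos.2 (pow_le_pow_left₀ (abs_nonneg _) h _))
      · exact mul_nonneg (sub_nonneg.2 (pow_le_pow_left₀ (abs_nonneg _) h _))
          (sub_nonneg.2 (pow_le_pow_left₀ (abs_nonneg _) h _))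
    have h2 : ∀ x : ℝ, x ^ (2 * r) = |x| ^ j * |x| ^ k := fun x => by
      rw [← pow_add, hjk, pow_mul, pow_mul, sq_abs]
    rw [h2, h2]
    have := h0 j k
    have := h0 k j
    nlinarith
  have hsumle : 2 * opTrace E (A ^ j * X * A ^ k * X)
      ≤ 2 * ∑ a, l a ^ (2 * r) * ‖X (b a)‖ ^ 2 := by
    have hpar : ∀ a, ∑ c, inner ℝ (b c) (X (b a)) ^ 2 = ‖X (b a)‖ ^ 2 := fun a => by
      rw [← b.sum_sq_norm_inner_right (X (b a))]
      simp
    have hsym : ∀ a c, inner ℝ (b c) (X (b a)) ^ 2 = inner ℝ (b a) (X (b c)) ^ 2 := fun a c => by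
      have := hXs (b c) (b a)
      simp only [ContinuousLinearMap.coe_coe] at this
      rw [← this, real_inner_comm]
    have e3 : ∑ a, ∑ c, l c ^ (2 * r) * inner ℝ (b c) (X (b a)) ^ 2
        = ∑ a, l a ^ (2 * r) * ‖X (b a)‖ ^ 2 := by
      rw [Finset.sum_comm]
      refine Finset.sum_congr rfl fun a _ => ?_
      rw [← Finset.mul_sum, ← hpar a]
      congr 1
      exact Finset.sum_congr rfl fun c _ => hsym c a
    have e4 : ∑ a, ∑ c, l a ^ (2 * r) * inner ℝ (b c) (X (b a)) ^ 2
        = ∑ a, l a ^ (2 * r) * ‖X (b a)‖ ^ 2 :=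
      Finset.sum_congr rfl fun a _ => by rw [← Finset.mul_sum, hpar]
    calc 2 * opTrace E (A ^ j * X * A ^ k * X)
        = opTrace E (A ^ j * X * A ^ k * X) + opTrace E (A ^ k * X * A ^ j * X) := by
          rw [← hcomm]; ring
      _ = ∑ a, ∑ c, (l a ^ j * l c ^ k + l a ^ k * l c ^ j) * inner ℝ (b c) (X (b a)) ^ 2 := by
          rw [key, key, ← Finset.sum_add_distrib]
          refine Finset.sum_congr rfl fun a _ => ?_
          rw [← Finset.sum_add_distrib]
          exact Finset.sum_congr rfl fun c _ => by ring
      _ ≤ ∑ a, ∑ c, (l a ^ (2 * r) + l c ^ (2 * r)) * inner ℝ (b c) (X (b a)) ^ 2 :=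
          Finset.sum_le_sum fun a _ => Finset.sum_le_sum fun c _ =>
            mul_le_mul_of_nonneg_right (hpt a c) (sq_nonneg _)
      _ = 2 * ∑ a, l a ^ (2 * r) * ‖X (b a)‖ ^ 2 := by
          simp only [add_mul, Finset.sum_add_distrib]
          rw [e3, e4]; ring
  have hfin : ∑ a, l a ^ (2 * r) * ‖X (b a)‖ ^ 2 ≤ ‖X‖ ^ 2 * opTrace E (A ^ (2 * r)) := by
    rw [opTrace_pow_eq_sum b l hb, Finset.mul_sum]
    refine Finset.sum_le_sum fun a _ => ?_
    rw [mul_comm]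
    have h1 : ‖X (b a)‖ ≤ ‖X‖ := by simpa using X.le_opNorm (b a)
    have h2 : 0 ≤ l a ^ (2 * r) := by rw [pow_mul]; positivity
    exact mul_le_mul_of_nonneg_right (pow_le_pow_left₀ (norm_nonneg _) h1 2) h2
  linarith

theorem opTrace_pow_two_mul_nonneg {A : E →L[ℝ] E} (hA : IsSelfAdjoint A) (p : ℕ) :
    0 ≤ opTrace E (A ^ (2 * p)) := by
  obtain ⟨b, l, hb⟩ := exists_orthonormal_eigenbasis hA
  rw [opTrace_pow_eq_sum b l hb]
  exact Finset.sum_nonneg fun i _ => by rw [pow_mul]; positivity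

theorem opNorm_pow_le_opTrace {A : E →L[ℝ] E} (hA : IsSelfAdjoint A) (p : ℕ) :
    ‖A‖ ^ (2 * (p + 1)) ≤ opTrace E (A ^ (2 * (p + 1))) := by
  obtain ⟨b, l, hb⟩ := exists_orthonormal_eigenbasis hA
  rw [opTrace_pow_eq_sum b l hb]
  set H := ∑ i, l i ^ (2 * (p + 1)) with hH
  have hH0 : 0 ≤ H := Finset.sum_nonneg fun i _ => by rw [pow_mul]; positivity
  set R : ℝ := H ^ ((1 : ℝ) / ((2 * (p + 1) : ℕ) : ℝ)) with hR
  have hR0 : 0 ≤ R := Real.rpow_nonneg hH0 _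
  have hRpow : R ^ (2 * (p + 1)) = H := by
    rw [hR, one_div]
    exact Real.rpow_inv_natCast_pow hH0 (by positivity)
  have hl : ∀ i, |l i| ≤ R := fun i => by
    have h1 : |l i| ^ (2 * (p + 1)) ≤ R ^ (2 * (p + 1)) := by
      rw [hRpow, pow_mul, sq_abs, ← pow_mul]
      exact Finset.single_le_sum (f := fun i => l i ^ (2 * (p + 1)))
        (fun i _ => by simp only [pow_mul]; positivity) (Finset.mem_univ i)
    exact le_of_pow_le_pow_left₀ (by positivity) hR0 h1
  have hn : ‖A‖ ≤ R := by
    refine A.opNorm_le_bound hR0 fun v => ?_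
    have e1 : A v = ∑ i, (inner ℝ (b i) v * l i) • b i := by
      conv_lhs => rw [← b.sum_repr' v]
      rw [map_sum]
      refine Finset.sum_congr rfl fun i _ => ?_
      have := hb 1 i
      simp only [pow_one] at this
      rw [map_smul, this, smul_smul]
    have e2 : ‖A v‖ ^ 2 = ∑ i, (inner ℝ (b i) v * l i) ^ 2 := by
      rw [← b.sum_sq_norm_inner_right (A v)]
      refine Finset.sum_congr rfl fun i _ => ?_
      rw [e1, b.orthonormal.inner_right_fintype, Real.norm_eq_abs, sq_abs]
    have e3 : ‖A v‖ ^ 2 ≤ (R * ‖v‖) ^ 2 := by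
      rw [e2, mul_pow, ← b.sum_sq_norm_inner_right v, Finset.mul_sum]
      refine Finset.sum_le_sum fun i _ => ?_
      rw [mul_pow, mul_comm, Real.norm_eq_abs, sq_abs]
      refine mul_le_mul_of_nonneg_right ?_ (sq_nonneg _)
      rw [← sq_abs]
      exact pow_le_pow_left₀ (abs_nonneg _) (hl i) 2
    exact le_of_pow_le_pow_left₀ two_ne_zero (by positivity) e3
  calc ‖A‖ ^ (2 * (p + 1)) ≤ R ^ (2 * (p + 1)) := pow_le_pow_left₀ (norm_nonneg _) hn _
    _ = H := hRpow

/-- Hölder against the constant function `1`, with exponents `p + 1` and `(p + 1) / p`. -/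
theorem sum_pow_le_rpow_mul_rpow {ι : Type*} [Fintype ι] (u : ι → ℝ) (hu : ∀ i, 0 ≤ u i)
    {p : ℕ} (hp : 1 ≤ p) :
    ∑ i, u i ^ p ≤ (Fintype.card ι : ℝ) ^ (1 / ((p : ℝ) + 1))
      * (∑ i, u i ^ (p + 1)) ^ (1 - 1 / ((p : ℝ) + 1)) := by
  have hp0 : (0 : ℝ) < p := by exact_mod_cast hp
  have hc : ((p : ℝ) + 1).HolderConjugate (((p : ℝ) + 1) / p) := by
    rw [Real.holderConjugate_iff]
    constructor
    · linarith
    · field_simp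
      ring
  have := Real.inner_le_Lp_mul_Lq_of_nonneg Finset.univ (f := fun _ => (1 : ℝ))
    (g := fun i => u i ^ p) hc (fun _ _ => zero_le_one) (fun i _ => pow_nonneg (hu i) _)
  simp only [one_mul, Real.one_rpow, Finset.sum_const, Finset.card_univ, nsmul_eq_mul,
    mul_one] at this
  refine this.trans_eq ?_
  congr 2
  · refine Finset.sum_congr rfl fun i _ => ?_
    rw [← Real.rpow_natCast, ← Real.rpow_mul (hu i), ← Real.rpow_natCast]
    congr 1
    push_cast
    field_simp
  · field_simp
    ring

theorem opTrace_pow_le_rpow {A : E →L[ℝ] E} (hA : IsSelfAdjoint A) {p : ℕ} (hp : 1 ≤ p) :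
    opTrace E (A ^ (2 * p)) ≤ (Module.finrank ℝ E : ℝ) ^ (1 / ((p : ℝ) + 1))
      * opTrace E (A ^ (2 * (p + 1))) ^ (1 - 1 / ((p : ℝ) + 1)) := by
  obtain ⟨b, l, hb⟩ := exists_orthonormal_eigenbasis hA
  rw [opTrace_pow_eq_sum b l hb, opTrace_pow_eq_sum b l hb]
  have := sum_pow_le_rpow_mul_rpow (fun i => l i ^ 2) (fun i => sq_nonneg _) hp
  simpa [← pow_mul] using this

/-- The power rule gives `N + 1` noncommuting products; cyclicity of the trace makes them all equal.
-/
theorem hasDerivAt_opTrace_pow (A X : E →L[ℝ] E) (N : ℕ) (s : ℝ) :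
    HasDerivAt (fun s : ℝ => opTrace E ((A + s • X) ^ (N + 1)))
      ((N + 1 : ℕ) * opTrace E ((A + s • X) ^ N * X)) s := by
  have hY : HasDerivAt (fun s : ℝ => A + s • X) X s := by
    simpa using ((hasDerivAt_id s).smul_const X).const_add A
  have h := (opTrace E).hasFDerivAt.comp_hasDerivAt s (hY.fun_pow' (N + 1))
  refine h.congr_deriv ?_
  rw [map_sum, Finset.sum_congr rfl (g := fun _ => opTrace E ((A + s • X) ^ N * X))]
  · simp
  · intro i hi
    have hi' : i ≤ N := by simpa [Nat.lt_succ_iff] using hi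
    rw [opTrace_mul_comm, ← mul_assoc, ← pow_add]
    congr 3
    simp only [Nat.pred_eq_sub_one]
    omega

theorem hasDerivAt_opTrace_pow_mul (A X : E →L[ℝ] E) (N : ℕ) (s : ℝ) :
    HasDerivAt (fun s : ℝ => opTrace E ((A + s • X) ^ N * X))
      (∑ i ∈ Finset.range N, opTrace E ((A + s • X) ^ (N - 1 - i) * X * (A + s • X) ^ i * X)) s := by
  have hY : HasDerivAt (fun s : ℝ => A + s • X) X s := by
    simpa using ((hasDerivAt_id s).smul_const X).const_add A
  have h := (opTrace E).hasFDerivAt.comp_hasDerivAt s ((hY.fun_pow' N).mul_const X)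
  refine h.congr_deriv ?_
  rw [Finset.sum_mul, map_sum]
  rfl

/-- A smoothing of the square of a Schatten norm of even order. -/
noncomputable def tracePotential (p : ℕ) (τ : ℝ) (A : E →L[ℝ] E) : ℝ :=
  (opTrace E (A ^ (2 * (p + 1))) + τ ^ (p + 1)) ^ (1 / ((p : ℝ) + 1))

theorem continuous_tracePotential (p : ℕ) (τ : ℝ) :
    Continuous (tracePotential (E := E) p τ) := by
  refine Continuous.rpow_const ?_ fun _ => Or.inr (by positivity)
  exact ((opTrace E).continuous.comp (continuous_pow _)).add continuous_const

theorem tracePotential_zero (p : ℕ) {τ : ℝ} (hτ : 0 ≤ τ) :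
    tracePotential p τ (0 : E →L[ℝ] E) = τ := by
  rw [tracePotential, zero_pow (by positivity), map_zero, zero_add, ← Real.rpow_natCast,
    ← Real.rpow_mul hτ]
  push_cast
  rw [mul_one_div_cancel (by positivity), Real.rpow_one]

theorem opNorm_sq_le_tracePotential (p : ℕ) {τ : ℝ} (hτ : 0 ≤ τ) {A : E →L[ℝ] E}
    (hA : IsSelfAdjoint A) : ‖A‖ ^ 2 ≤ tracePotential p τ A := by
  have h1 := opNorm_pow_le_opTrace hA p
  have h2 : (‖A‖ ^ 2) ^ (p + 1) ≤ opTrace E (A ^ (2 * (p + 1))) + τ ^ (p + 1) := by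
    rw [← pow_mul]
    have : 0 ≤ τ ^ (p + 1) := by positivity
    linarith
  calc ‖A‖ ^ 2 = ((‖A‖ ^ 2) ^ (p + 1)) ^ (1 / ((p : ℝ) + 1)) := by
        rw [← Real.rpow_natCast _ (p + 1), ← Real.rpow_mul (by positivity)]
        push_cast
        rw [mul_one_div_cancel (by positivity), Real.rpow_one]
    _ ≤ _ := Real.rpow_le_rpow (by positivity) h2 (by positivity)

theorem le_add_of_second_deriv_le {g g₁ g₂ : ℝ → ℝ} {K : ℝ} (h₁ : ∀ s, HasDerivAt g (g₁ s) s)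
    (h₂ : ∀ s, HasDerivAt g₁ (g₂ s) s) (hK : ∀ s, g₂ s ≤ 2 * K) : g 1 ≤ g 0 + g₁ 0 + K := by
  have a1 : ∀ s, 0 ≤ s → g₁ s ≤ g₁ 0 + 2 * K * s := fun s hs => by
    have := image_sub_le_mul_sub_of_deriv_le (f := g₁) (fun s => (h₂ s).differentiableAt)
      (C := 2 * K) (fun s => by rw [(h₂ s).deriv]; exact hK s) hs
    linarith
  have a2 : AntitoneOn (fun s => g s - g₁ 0 * s - K * s ^ 2) (Set.Ici 0) := by
    have hd : ∀ s, HasDerivAt (fun s => g s - g₁ 0 * s - K * s ^ 2)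
        (g₁ s - g₁ 0 - 2 * K * s) s := fun s => by
      have := ((h₁ s).sub ((hasDerivAt_id s).const_mul (g₁ 0))).sub
        ((hasDerivAt_pow 2 s).const_mul K)
      refine this.congr_deriv ?_
      simp
      ring
    refine antitoneOn_of_deriv_nonpos (convex_Ici 0)
      (fun s _ => (hd s).continuousAt.continuousWithinAt)
      (fun s _ => (hd s).differentiableAt.differentiableWithinAt) fun s hs => ?_
    rw [interior_Ici] at hs
    rw [(hd s).deriv]
    have := a1 s (le_of_lt hs)
    linarith
  have := a2 (Set.mem_Ici.2 le_rfl) (Set.mem_Ici.2 zero_le_one) zero_le_one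
  simp only at this
  linarith

/-- Since `q ≤ 1`, the term of `(h^q)''` containing `h₁²` is nonpositive and can be dropped. In the
other term the growth assumed in `hb` cancels the factor `h^(q - 1)`. -/
theorem rpow_le_add_of_second_deriv_le {h h₁ h₂ : ℝ → ℝ} {q R : ℝ} (hq0 : 0 < q) (hq1 : q ≤ 1)
    (hpos : ∀ s, 0 < h s) (d1 : ∀ s, HasDerivAt h (h₁ s) s) (d2 : ∀ s, HasDerivAt h₁ (h₂ s) s)
    (hb : ∀ s, h₂ s ≤ 2 * q⁻¹ * R * h s ^ (1 - q)) :
    h 1 ^ q ≤ h 0 ^ q + q * h 0 ^ (q - 1) * h₁ 0 + R := by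
  have e1 : ∀ s, HasDerivAt (fun s => h s ^ q) (q * h s ^ (q - 1) * h₁ s) s := fun s => by
    refine ((d1 s).rpow_const (p := q) (Or.inl (hpos s).ne')).congr_deriv ?_
    ring
  have e2 : ∀ s, HasDerivAt (fun s => q * h s ^ (q - 1) * h₁ s)
      (q * ((q - 1) * h s ^ (q - 2) * h₁ s ^ 2) + q * h s ^ (q - 1) * h₂ s) s := fun s => by
    refine ((((d1 s).rpow_const (p := q - 1) (Or.inl (hpos s).ne')).const_mul q).mul
      (d2 s)).congr_deriv ?_
    rw [show q - 1 - 1 = q - 2 by ring]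
    ring
  refine le_add_of_second_deriv_le e1 e2 fun s => ?_
  have n1 : q * ((q - 1) * h s ^ (q - 2) * h₁ s ^ 2) ≤ 0 := by
    have : 0 ≤ h s ^ (q - 2) * h₁ s ^ 2 := mul_nonneg (Real.rpow_nonneg (hpos s).le _) (sq_nonneg _)
    have h3 : (q - 1) * (h s ^ (q - 2) * h₁ s ^ 2) ≤ 0 :=
      mul_nonpos_of_nonpos_of_nonneg (by linarith) this
    have := mul_nonpos_of_nonneg_of_nonpos hq0.le h3
    linarith [mul_assoc (q - 1) (h s ^ (q - 2)) (h₁ s ^ 2)]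
  have n3 : q * h s ^ (q - 1) * h₂ s ≤ q * h s ^ (q - 1) * (2 * q⁻¹ * R * h s ^ (1 - q)) :=
    mul_le_mul_of_nonneg_left (hb s) (mul_nonneg hq0.le (Real.rpow_nonneg (hpos s).le _))
  have n4 : h s ^ (q - 1) * h s ^ (1 - q) = 1 := by
    rw [← Real.rpow_add (hpos s)]; simp
  have n5 : q * h s ^ (q - 1) * (2 * q⁻¹ * R * h s ^ (1 - q)) = 2 * R := by
    calc _ = (q * q⁻¹) * (h s ^ (q - 1) * h s ^ (1 - q)) * (2 * R) := by ring
      _ = _ := by rw [n4, mul_inv_cancel₀ hq0.ne']; ring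
  linarith

theorem isSelfAdjoint_add_smul {A X : E →L[ℝ] E} (hA : IsSelfAdjoint A) (hX : IsSelfAdjoint X)
    (s : ℝ) : IsSelfAdjoint (A + s • X) := by
  rw [ContinuousLinearMap.isSelfAdjoint_iff_isSymmetric] at *
  intro v w
  have h1 := hA v w
  have h2 := hX v w
  simp only [ContinuousLinearMap.coe_coe] at h1 h2
  simp [inner_add_left, inner_add_right, inner_smul_left, inner_smul_right, h1, h2]

/-- The second derivative of `tr (A + sX)^(2p+2)` has `2p + 1` terms, each at most `‖X‖² tr Y^(2p)`
with `Y = A + sX`, times `2(p+1)`. Hölder bounds `tr Y^(2p)` by `n^q (tr Y^(2p+2))^(1-q)` with `q =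
1/(p+1)`, exactly the growth that taking the power `q` can absorb. The shift by `τ^(p+1)` keeps the
base positive, so that this power is differentiable. -/
theorem tracePotential_add_le {p : ℕ} (hp : 1 ≤ p) {τ : ℝ} (hτ : 0 < τ) {A : E →L[ℝ] E}
    (hA : IsSelfAdjoint A) :
    ∃ ℓ : (E →L[ℝ] E) →L[ℝ] ℝ, ∀ X : E →L[ℝ] E, IsSelfAdjoint X →
      tracePotential p τ (A + X) ≤ tracePotential p τ A + ℓ X
        + ((2 * p + 1) * (Module.finrank ℝ E : ℝ) ^ (1 / ((p : ℝ) + 1))) * ‖X‖ ^ 2 := by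
  have hp1 : (0 : ℝ) < (p : ℝ) + 1 := by positivity
  obtain ⟨q, hq⟩ : ∃ q : ℝ, q = 1 / ((p : ℝ) + 1) := ⟨_, rfl⟩
  have hq0 : 0 < q := by rw [hq]; positivity
  have hq1 : q ≤ 1 := by
    rw [hq, div_le_one hp1]
    have : (0 : ℝ) ≤ p := by positivity
    linarith
  have hqi : q⁻¹ = (p : ℝ) + 1 := by rw [hq]; simp
  obtain ⟨η, hηdef⟩ : ∃ η : ℝ, η = τ ^ (p + 1) := ⟨_, rfl⟩
  have hη : 0 < η := by rw [hηdef]; positivity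
  -- The linear functional is the derivative of the potential at `A`.
  refine ⟨(q * (opTrace E (A ^ (2 * (p + 1))) + η) ^ (q - 1) * (2 * (p + 1))) •
    (opTrace E ∘L ContinuousLinearMap.mul ℝ (E →L[ℝ] E) (A ^ (2 * p + 1))), fun X hX => ?_⟩
  have hYsa : ∀ s : ℝ, IsSelfAdjoint (A + s • X) := fun s => isSelfAdjoint_add_smul hA hX s
  have hpos : ∀ s : ℝ, 0 < opTrace E ((A + s • X) ^ (2 * (p + 1))) + η := fun s =>
    add_pos_of_nonneg_of_pos (opTrace_pow_two_mul_nonneg (hYsa s) _) hη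
  have d1 : ∀ s : ℝ, HasDerivAt (fun s : ℝ => opTrace E ((A + s • X) ^ (2 * (p + 1))) + η)
      ((2 * (p + 1)) * opTrace E ((A + s • X) ^ (2 * p + 1) * X)) s := fun s => by
    have := (hasDerivAt_opTrace_pow A X (2 * p + 1) s).add_const η
    refine this.congr_deriv ?_
    push_cast
    ring
  have d2 : ∀ s : ℝ, HasDerivAt
      (fun s : ℝ => (2 * (p + 1)) * opTrace E ((A + s • X) ^ (2 * p + 1) * X)) _ s := fun s =>
    (hasDerivAt_opTrace_pow_mul A X (2 * p + 1) s).const_mul (2 * ((p : ℝ) + 1))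
  obtain ⟨c, hc⟩ : ∃ c : ℝ, c = (Module.finrank ℝ E : ℝ) ^ q := ⟨_, rfl⟩
  have hc0 : 0 ≤ c := by rw [hc]; exact Real.rpow_nonneg (by positivity) _
  have main := rpow_le_add_of_second_deriv_le (R := (2 * p + 1) * c * ‖X‖ ^ 2) hq0 hq1 hpos d1 d2
    fun s => by
      have t1 : opTrace E ((A + s • X) ^ (2 * p))
          ≤ c * (opTrace E ((A + s • X) ^ (2 * (p + 1))) + η) ^ (1 - q) := by
        refine (opTrace_pow_le_rpow (hYsa s) hp).trans ?_
        rw [hc, ← hq]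
        refine mul_le_mul_of_nonneg_left ?_ (Real.rpow_nonneg (by positivity) _)
        exact Real.rpow_le_rpow (opTrace_pow_two_mul_nonneg (hYsa s) _) (by linarith) (by linarith)
      have t2 : ∀ i ∈ Finset.range (2 * p + 1),
          opTrace E ((A + s • X) ^ (2 * p + 1 - 1 - i) * X * (A + s • X) ^ i * X)
          ≤ ‖X‖ ^ 2 * (c * (opTrace E ((A + s • X) ^ (2 * (p + 1))) + η) ^ (1 - q)) := by
        intro i hi
        have hi' : i < 2 * p + 1 := by simpa using hi
        refine (opTrace_pow_mul_pow_mul_le (hYsa s) hX (r := p) (by omega)).trans ?_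
        exact mul_le_mul_of_nonneg_left t1 (sq_nonneg _)
      have t3 := Finset.sum_le_card_nsmul _ _ _ t2
      rw [Finset.card_range, nsmul_eq_mul] at t3
      rw [hqi]
      refine (mul_le_mul_of_nonneg_left t3 (by positivity)).trans_eq ?_
      push_cast
      ring
  simp only [one_smul, zero_smul, add_zero] at main
  simp only [tracePotential, smul_apply, ContinuousLinearMap.comp_apply,
    ContinuousLinearMap.mul_apply', smul_eq_mul, ← hq, ← hηdef, ← hc]
  linarith

end TracePotential

/-! ### Mean error of sample averages, for vectors and for operators. -/

section Batch

/-- If `φ` has quadratic growth with constant `L` around each point, then sums of `m` independent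
centered random vectors satisfy `E φ(X₁ + ⋯ + X_m) ≤ φ(0) + m L E‖X‖²`. -/
theorem lintegral_potential_sum_le {E Ξ : Type*} [NormedAddCommGroup E] [NormedSpace ℝ E]
    [CompleteSpace E] [MeasurableSpace E] [BorelSpace E] [SecondCountableTopology E]
    [MeasurableSpace Ξ] (P : Measure Ξ) [IsProbabilityMeasure P] {Y : Ξ → E} (hY : Measurable Y)
    (hYint : Integrable Y P) (hY0 : ∫ ξ, Y ξ ∂P = 0) (hYsq : Integrable (fun ξ => ‖Y ξ‖ ^ 2) P)
    {v : ℝ} (hv : ∫ ξ, ‖Y ξ‖ ^ 2 ∂P ≤ v) {φ : E → ℝ} (hφ : Continuous φ) (W : AddSubgroup E)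
    (hYW : ∀ ξ, Y ξ ∈ W) (hφ0 : ∀ A ∈ W, 0 ≤ φ A) {L : ℝ} (hL : 0 ≤ L)
    (hsm : ∀ A ∈ W, ∃ ℓ : E →L[ℝ] ℝ, ∀ X ∈ W, φ (A + X) ≤ φ A + ℓ X + L * ‖X‖ ^ 2) (m : ℕ) :
    ∫⁻ s : Fin m → Ξ, ENNReal.ofReal (φ (∑ i, Y (s i))) ∂(Measure.pi fun _ => P)
      ≤ ENNReal.ofReal (φ 0 + m * (L * v)) := by
  have hv0 : 0 ≤ v := (integral_nonneg fun _ => by positivity).trans hv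
  induction m with
  | zero => simp
  | succ m ih =>
    have hmp := (measurePreserving_piFinSuccAbove (fun _ : Fin (m + 1) => P) 0).symm
    have hmeas : ∀ m, Measurable fun s : Fin m → Ξ => ∑ i, Y (s i) := fun m =>
      Finset.measurable_sum _ fun i _ => hY.comp (measurable_pi_apply i)
    have hm2 : ∀ m, Measurable fun s : Fin m → Ξ => ENNReal.ofReal (φ (∑ i, Y (s i))) := fun m =>
      (hφ.measurable.comp (hmeas m)).ennreal_ofReal
    have hW : ∀ s : Fin m → Ξ, ∑ i, Y (s i) ∈ W := fun s => W.sum_mem fun i _ => hYW _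
    -- One further independent sample: the linear term has mean zero, so only `L v` is added.
    have hstep : ∀ A ∈ W, ∫⁻ ξ, ENNReal.ofReal (φ (A + Y ξ)) ∂P
        ≤ ENNReal.ofReal (φ A + L * v) := fun A hA => by
      obtain ⟨ℓ, hℓ⟩ := hsm A hA
      have hi : Integrable (fun ξ => φ A + ℓ (Y ξ) + L * ‖Y ξ‖ ^ 2) P :=
        ((integrable_const _).add (ℓ.integrable_comp hYint)).add (hYsq.const_mul L)
      calc ∫⁻ ξ, ENNReal.ofReal (φ (A + Y ξ)) ∂P
          ≤ ∫⁻ ξ, ENNReal.ofReal (φ A + ℓ (Y ξ) + L * ‖Y ξ‖ ^ 2) ∂P :=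
            lintegral_mono fun ξ => ENNReal.ofReal_le_ofReal (hℓ _ (hYW ξ))
        _ = ENNReal.ofReal (∫ ξ, (φ A + ℓ (Y ξ) + L * ‖Y ξ‖ ^ 2) ∂P) :=
            (ofReal_integral_eq_lintegral_ofReal hi (Filter.Eventually.of_forall fun ξ =>
              (hφ0 _ (W.add_mem hA (hYW ξ))).trans (hℓ _ (hYW ξ)))).symm
        _ ≤ _ := by
            refine ENNReal.ofReal_le_ofReal ?_
            have hi1 : Integrable (fun ξ => φ A + ℓ (Y ξ)) P :=
              (integrable_const _).add (ℓ.integrable_comp hYint)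
            rw [integral_add hi1 (hYsq.const_mul L),
              integral_add (integrable_const _) (ℓ.integrable_comp hYint),
              ℓ.integral_comp_comm hYint, hY0, integral_const_mul]
            simp only [integral_const, map_zero, probReal_univ, one_smul, add_zero]
            gcongr
    rw [← hmp.lintegral_comp (hm2 (m + 1))]
    have e : ∀ p : Ξ × (Fin m → Ξ),
        ∑ i, Y ((MeasurableEquiv.piFinSuccAbove (fun _ : Fin (m + 1) => Ξ) 0).symm p i)
          = Y p.1 + ∑ i, Y (p.2 i) := fun p => by
      rw [Fin.sum_univ_succ]
      rfl
    simp only [e]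
    rw [lintegral_prod_symm']
    · calc _ ≤ ∫⁻ s : Fin m → Ξ, (ENNReal.ofReal (φ (∑ i, Y (s i))) + ENNReal.ofReal (L * v))
            ∂(Measure.pi fun _ => P) := by
            refine lintegral_mono fun s => ?_
            rw [← ENNReal.ofReal_add (hφ0 _ (hW s)) (by positivity)]
            simpa only [add_comm] using hstep _ (hW s)
        _ = ∫⁻ s : Fin m → Ξ, ENNReal.ofReal (φ (∑ i, Y (s i))) ∂(Measure.pi fun _ => P)
            + ENNReal.ofReal (L * v) := by
            rw [lintegral_add_right _ measurable_const]
            simp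
        _ ≤ ENNReal.ofReal (φ 0 + m * (L * v)) + ENNReal.ofReal (L * v) := by gcongr
        _ = _ := by
            have := hφ0 0 W.zero_mem
            rw [← ENNReal.ofReal_add (by positivity) (by positivity)]
            push_cast
            congr 1
            ring
    · exact (hφ.measurable.comp ((hY.comp measurable_fst).add
        ((hmeas m).comp measurable_snd))).ennreal_ofReal

/-- `f ≤ f² / (2θ) + θ / 2` pointwise; this needs no measurability of `f`. -/
theorem lintegral_ofReal_le_of_sq {α : Type*} [MeasurableSpace α] (μ : Measure α)
    [IsProbabilityMeasure μ] (f : α → ℝ) {θ : ℝ} (hθ : 0 < θ)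
    (h : ∫⁻ a, ENNReal.ofReal (f a ^ 2) ∂μ ≤ ENNReal.ofReal (θ ^ 2)) :
    ∫⁻ a, ENNReal.ofReal (f a) ∂μ ≤ ENNReal.ofReal θ := by
  have hc : 0 ≤ (2 * θ)⁻¹ := by positivity
  calc ∫⁻ a, ENNReal.ofReal (f a) ∂μ
      ≤ ∫⁻ a, (ENNReal.ofReal ((2 * θ)⁻¹) * ENNReal.ofReal (f a ^ 2) + ENNReal.ofReal (θ / 2)) ∂μ := by
        refine lintegral_mono fun a => ?_
        rw [← ENNReal.ofReal_mul hc, ← ENNReal.ofReal_add (by positivity) (by positivity)]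
        refine ENNReal.ofReal_le_ofReal ?_
        have : 0 ≤ (2 * θ)⁻¹ * (f a - θ) ^ 2 := by positivity
        have e : (2 * θ)⁻¹ * (f a - θ) ^ 2 = (2 * θ)⁻¹ * f a ^ 2 + θ / 2 - f a := by
          field_simp
          ring
        linarith
    _ = ENNReal.ofReal ((2 * θ)⁻¹) * ∫⁻ a, ENNReal.ofReal (f a ^ 2) ∂μ + ENNReal.ofReal (θ / 2) := by
        rw [lintegral_add_right _ measurable_const, lintegral_const_mul' _ _ ENNReal.ofReal_ne_top]
        simp
    _ ≤ ENNReal.ofReal ((2 * θ)⁻¹) * ENNReal.ofReal (θ ^ 2) + ENNReal.ofReal (θ / 2) := by gcongr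
    _ = ENNReal.ofReal θ := by
        rw [← ENNReal.ofReal_mul hc, ← ENNReal.ofReal_add (by positivity) (by positivity)]
        congr 1
        field_simp
        ring

/-- The potential `φ` dominates the squared norm, so its bound on sums of centered samples, divided
by `m²`, controls the second moment of the average. The subgroup `W` allows `φ` to be controlled on
self-adjoint operators only. -/
theorem lintegral_norm_batch_sub_le {E Ξ : Type*} [NormedAddCommGroup E] [NormedSpace ℝ E]
    [CompleteSpace E] [MeasurableSpace E] [BorelSpace E] [SecondCountableTopology E]
    [MeasurableSpace Ξ] (P : Measure Ξ) [IsProbabilityMeasure P] {Z : Ξ → E} (hZ : Measurable Z)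
    (hZint : Integrable Z P) {z : E} (hz : ∫ ξ, Z ξ ∂P = z)
    (hsq : Integrable (fun ξ => ‖Z ξ - z‖ ^ 2) P) {v : ℝ} (hv : ∫ ξ, ‖Z ξ - z‖ ^ 2 ∂P ≤ v)
    {φ : E → ℝ} (hφ : Continuous φ) (W : AddSubgroup E) (hZW : ∀ ξ, Z ξ ∈ W) (hzW : z ∈ W)
    (hφ0 : ∀ A ∈ W, ‖A‖ ^ 2 ≤ φ A) {L : ℝ} (hL : 0 ≤ L)
    (hsm : ∀ A ∈ W, ∃ ℓ : E →L[ℝ] ℝ, ∀ X ∈ W, φ (A + X) ≤ φ A + ℓ X + L * ‖X‖ ^ 2) {m : ℕ}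
    (hm : 0 < m) {θ : ℝ} (hθ : 0 < θ) (hθm : φ 0 + m * (L * v) ≤ (m * θ) ^ 2) :
    ∫⁻ s : Fin m → Ξ, ENNReal.ofReal ‖(m : ℝ)⁻¹ • ∑ i, Z (s i) - z‖ ∂(Measure.pi fun _ => P)
      ≤ ENNReal.ofReal θ := by
  have hm0 : (0 : ℝ) < m := by exact_mod_cast hm
  refine lintegral_ofReal_le_of_sq _ _ hθ ?_
  have key := lintegral_potential_sum_le P (Y := fun ξ => Z ξ - z) (hZ.sub_const z)
    (hZint.sub (integrable_const z)) (by rw [integral_sub hZint (integrable_const z)]; simp [hz])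
    hsq hv hφ W (fun ξ => W.sub_mem (hZW ξ) hzW) (fun A hA => (sq_nonneg _).trans (hφ0 A hA)) hL
    hsm m
  have hpt : ∀ s : Fin m → Ξ, ‖(m : ℝ)⁻¹ • ∑ i, Z (s i) - z‖ ^ 2
      ≤ ((m : ℝ) ^ 2)⁻¹ * φ (∑ i, (Z (s i) - z)) := fun s => by
    have e : (m : ℝ)⁻¹ • ∑ i, Z (s i) - z = (m : ℝ)⁻¹ • ∑ i, (Z (s i) - z) := by
      rw [Finset.sum_sub_distrib, smul_sub]
      simp only [Finset.sum_const, Finset.card_univ, Fintype.card_fin]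
      rw [← Nat.cast_smul_eq_nsmul ℝ, smul_smul, inv_mul_cancel₀ hm0.ne', one_smul]
    rw [e, norm_smul, mul_pow, norm_inv, Real.norm_eq_abs, abs_of_pos hm0, inv_pow]
    exact mul_le_mul_of_nonneg_left
      (hφ0 _ (W.sum_mem fun i _ => W.sub_mem (hZW _) hzW)) (by positivity)
  calc _ ≤ ∫⁻ s : Fin m → Ξ, ENNReal.ofReal ((m : ℝ) ^ 2)⁻¹
        * ENNReal.ofReal (φ (∑ i, (Z (s i) - z))) ∂(Measure.pi fun _ => P) := by
        refine lintegral_mono fun s => ?_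
        rw [← ENNReal.ofReal_mul (by positivity)]
        exact ENNReal.ofReal_le_ofReal (hpt s)
    _ ≤ ENNReal.ofReal ((m : ℝ) ^ 2)⁻¹ * ENNReal.ofReal ((m * θ) ^ 2) := by
        rw [lintegral_const_mul' _ _ ENNReal.ofReal_ne_top]
        gcongr
        exact key.trans (ENNReal.ofReal_le_ofReal hθm)
    _ = ENNReal.ofReal (θ ^ 2) := by
        rw [← ENNReal.ofReal_mul (by positivity)]
        congr 1
        field_simp

theorem lintegral_norm_batch_vec_sub_le {E Ξ : Type*} [NormedAddCommGroup E]
    [InnerProductSpace ℝ E] [CompleteSpace E] [MeasurableSpace E] [BorelSpace E]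
    [SecondCountableTopology E]
    [MeasurableSpace Ξ] (P : Measure Ξ) [IsProbabilityMeasure P] {Z : Ξ → E} (hZ : Measurable Z)
    (hZint : Integrable Z P) {z : E} (hz : ∫ ξ, Z ξ ∂P = z)
    (hsq : Integrable (fun ξ => ‖Z ξ - z‖ ^ 2) P) {v : ℝ} (hv : ∫ ξ, ‖Z ξ - z‖ ^ 2 ∂P ≤ v)
    {m : ℕ} (hm : 0 < m) {θ : ℝ} (hθ : 0 < θ) (hθm : v ≤ m * θ ^ 2) :
    ∫⁻ s : Fin m → Ξ, ENNReal.ofReal ‖(m : ℝ)⁻¹ • ∑ i, Z (s i) - z‖ ∂(Measure.pi fun _ => P)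
      ≤ ENNReal.ofReal θ := by
  have hm0 : (0 : ℝ) < m := by exact_mod_cast hm
  refine lintegral_norm_batch_sub_le P hZ hZint hz hsq hv (φ := fun x => ‖x‖ ^ 2) (L := 1)
    (by fun_prop) ⊤ (fun _ => trivial) trivial (fun _ _ => le_rfl) zero_le_one
    (fun A _ => ⟨(2 : ℝ) • innerSL ℝ A, fun X _ => ?_⟩) hm hθ ?_
  · simp only [smul_apply, innerSL_apply_apply, smul_eq_mul, one_mul]
    rw [norm_add_sq_real]
  · simp only [norm_zero]
    nlinarith

theorem lintegral_opNorm_batch_sub_le {E Ξ : Type*} [NormedAddCommGroup E]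
    [InnerProductSpace ℝ E] [FiniteDimensional ℝ E] (hn : 2 ≤ Module.finrank ℝ E)
    [MeasurableSpace Ξ] (P : Measure Ξ) [IsProbabilityMeasure P] {Z : Ξ → E →L[ℝ] E}
    (hZ : Measurable Z) (hZsa : ∀ ξ, IsSelfAdjoint (Z ξ))
    (hZint : Integrable Z P) {z : E →L[ℝ] E} (hzsa : IsSelfAdjoint z) (hz : ∫ ξ, Z ξ ∂P = z)
    (hsq : Integrable (fun ξ => ‖Z ξ - z‖ ^ 2) P) {v : ℝ} (hv : ∫ ξ, ‖Z ξ - z‖ ^ 2 ∂P ≤ v)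
    {m : ℕ} {ε : ℝ} (hε : 0 < ε) (hm : 22 * Real.log (Module.finrank ℝ E) * ε⁻¹ ≤ m)
    {θ : ℝ} (hθ : 0 < θ) (hθv : ε * (1 + v) ≤ θ ^ 2) :
    ∫⁻ s : Fin m → Ξ, ENNReal.ofReal ‖(m : ℝ)⁻¹ • ∑ i, Z (s i) - z‖ ∂(Measure.pi fun _ => P)
      ≤ ENNReal.ofReal θ := by
  set n := Module.finrank ℝ E with hn'
  have hv0 : 0 ≤ v := (integral_nonneg fun _ => by positivity).trans hv
  have hnR : (2 : ℝ) ≤ n := by exact_mod_cast hn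
  have hlog2 : 0.69 ≤ Real.log n :=
    (by linarith [Real.log_two_gt_d9] : (0.69 : ℝ) ≤ Real.log 2).trans
      (Real.log_le_log (by norm_num) hnR)
  have hm0 : (0 : ℝ) < m := lt_of_lt_of_le (by positivity) hm
  -- With `p ≥ log n` the dimension factor `n^(1/(p+1))` is at most `e`, and `(2p+1) e ≤ 22 log n`
  -- because `log n ≥ log 2`.
  obtain ⟨p, hp⟩ : ∃ p : ℕ, p = ⌈Real.log n⌉₊ := ⟨_, rfl⟩
  have hp1 : 1 ≤ p := by rw [hp]; exact Nat.one_le_ceil_iff.2 (by linarith)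
  have hple : (p : ℝ) ≤ Real.log n + 1 := by
    rw [hp]; exact (Nat.ceil_lt_add_one (by linarith)).le
  have hpge : Real.log n ≤ p := by rw [hp]; exact Nat.le_ceil _
  have hL : (2 * p + 1) * (n : ℝ) ^ (1 / ((p : ℝ) + 1)) ≤ 22 * Real.log n := by
    have h1 : (n : ℝ) ^ (1 / ((p : ℝ) + 1)) ≤ 2.7182818286 := by
      rw [Real.rpow_def_of_pos (by linarith)]
      refine le_trans ?_ Real.exp_one_lt_d9.le
      rw [Real.exp_le_exp, mul_one_div, div_le_one (by positivity)]
      linarith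
    calc _ ≤ (2 * (Real.log n + 1) + 1) * 2.7182818286 := by gcongr
      _ ≤ _ := by linarith
  -- The smoothing level `τ = m² ε` is chosen to contribute the same order as the variance: after
  -- division by `m²` the total is `ε (1 + v)`.
  refine lintegral_norm_batch_sub_le P hZ hZint hz hsq hv
    (φ := tracePotential p ((m : ℝ) ^ 2 * ε))
    (L := (2 * p + 1) * (n : ℝ) ^ (1 / ((p : ℝ) + 1))) (continuous_tracePotential _ _)
    (selfAdjoint (E →L[ℝ] E)) hZsa hzsa
    (fun A hA => opNorm_sq_le_tracePotential p (by positivity) hA) (by positivity)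
    (fun A hA => ?_) (by exact_mod_cast hm0) hθ ?_
  · obtain ⟨ℓ, hℓ⟩ := tracePotential_add_le hp1 (τ := (m : ℝ) ^ 2 * ε) (by positivity)
      (show IsSelfAdjoint A from hA)
    exact ⟨ℓ, fun X hX => hℓ X hX⟩
  · rw [tracePotential_zero p (by positivity)]
    have h1 : 22 * Real.log n ≤ m * ε := by
      have := mul_le_mul_of_nonneg_right hm hε.le
      rwa [mul_assoc, inv_mul_cancel₀ hε.ne', mul_one] at this
    calc _ ≤ (m : ℝ) ^ 2 * ε + m * (m * ε * v) := by
          have := mul_le_mul_of_nonneg_right (hL.trans h1) hv0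
          gcongr
      _ = (m : ℝ) ^ 2 * (ε * (1 + v)) := by ring
      _ ≤ (m : ℝ) ^ 2 * θ ^ 2 := by gcongr
      _ = _ := by ring

end Batch

namespace TrustRegion

variable {n k : ℕ}

/-! ### Taylor estimates under generalized smoothness. -/

section Hessian

theorem inner_gradient_left {F : Vec n → ℝ} (x v : Vec n) :
    inner ℝ (gradient F x) v = fderiv ℝ F x v :=
  InnerProductSpace.toDual_symm_apply

theorem hess_isSymmetric {F : Vec n → ℝ} (hF : TwiceDifferentiable F) (x : Vec n) :
    IsSelfAdjoint (hess F x) := by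
  rw [ContinuousLinearMap.isSelfAdjoint_iff_isSymmetric]
  have h2 : HasFDerivAt (fderiv ℝ F)
      ((InnerProductSpace.toDual ℝ (Vec n)).toContinuousLinearEquiv.toContinuousLinearMap ∘L
        hess F x) x := by
    have h := (InnerProductSpace.toDual ℝ (Vec n)).toContinuousLinearEquiv.toContinuousLinearMap.hasFDerivAt.comp
      x (hF.2 x).hasFDerivAt
    refine h.congr_of_eventuallyEq (Filter.Eventually.of_forall fun y => ?_)
    exact (toDual_gradient (𝕜 := ℝ) (f := F) (x := y)).symm
  intro v w
  have := second_derivative_symmetric (fun y => (hF.1 y).hasFDerivAt) h2 v w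
  simp only [ContinuousLinearMap.coe_coe]
  rw [real_inner_comm (hess F x w)]
  exact this

theorem continuous_gradient {F : Vec n → ℝ} (hF : TwiceDifferentiable F) :
    Continuous (gradient F) := hF.2.continuous

theorem SecondOrderSmooth.continuous_hess {F : Vec n → ℝ} {δ M₀ M₁ : ℝ} (hδ : 0 < δ)
    (hF : SecondOrderSmooth F δ M₀ M₁) : Continuous (hess F) := by
  refine continuous_iff_continuousAt.2 fun x => ?_
  rw [ContinuousAt, tendsto_iff_norm_sub_tendsto_zero]
  have h1 : Filter.Tendsto (fun y => (M₀ + M₁ * ‖gradient F x‖) * ‖x - y‖) (nhds x) (nhds 0) := by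
    have : Continuous fun y => (M₀ + M₁ * ‖gradient F x‖) * ‖x - y‖ := by fun_prop
    simpa using this.tendsto x
  refine squeeze_zero' (Filter.Eventually.of_forall fun _ => norm_nonneg _) ?_ h1
  filter_upwards [Metric.ball_mem_nhds x hδ] with y hy
  rw [norm_sub_rev]
  refine hF.2 x y ?_
  rw [← dist_eq_norm, dist_comm]
  exact (Metric.mem_ball.1 hy).le

theorem GeneralizedSmooth.norm_hess_le {F : Vec n → ℝ} {L₀ L₁ : ℝ} (hL₀ : 0 ≤ L₀) (hL₁ : 0 ≤ L₁)
    (hF : GeneralizedSmooth F L₀ L₁) (hF2 : TwiceDifferentiable F) (x : Vec n) :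
    ‖hess F x‖ ≤ L₀ + L₁ * ‖gradient F x‖ := by
  refine (hF2.2 x).hasFDerivAt.le_of_lip' (by positivity) ?_
  have h1 : ∀ᶠ y in nhds x, L₁ * ‖x - y‖ < 1 := by
    have : Continuous fun y => L₁ * ‖x - y‖ := by fun_prop
    exact this.continuousAt.eventually_lt continuousAt_const (by simp)
  filter_upwards [h1] with y hy
  rw [norm_sub_rev, norm_sub_rev y]
  exact hF.2 x y hy.le

/-- A crude growth bound per step, from which come integrability along the run and the case of large
`ε`. -/
theorem GeneralizedSmooth.norm_gradient_le_add {F : Vec n → ℝ} {L₀ L₁ Δ : ℝ} (hL₀ : 0 ≤ L₀)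
    (hL₁ : 0 ≤ L₁) (hΔ : L₁ * Δ ≤ 1) (hF : GeneralizedSmooth F L₀ L₁) {x d : Vec n}
    (hd : ‖d‖ ≤ Δ) : ‖gradient F (x + d)‖ ≤ 2 * ‖gradient F x‖ + L₀ * Δ := by
  have h1 : L₁ * ‖d‖ ≤ 1 := (mul_le_mul_of_nonneg_left hd hL₁).trans hΔ
  have h2 := hF.2 x (x + d) (by simpa using h1)
  rw [sub_add_cancel_left, norm_neg] at h2
  have h3 : ‖gradient F (x + d)‖ ≤ ‖gradient F x‖ + ‖gradient F x - gradient F (x + d)‖ := by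
    rw [norm_sub_rev]; exact norm_le_insert' _ _
  have h4 : L₀ * ‖d‖ ≤ L₀ * Δ := mul_le_mul_of_nonneg_left hd hL₀
  have h5 : L₁ * ‖d‖ * ‖gradient F x‖ ≤ 1 * ‖gradient F x‖ :=
    mul_le_mul_of_nonneg_right h1 (norm_nonneg _)
  nlinarith

theorem hasDerivAt_along {F : Vec n → ℝ} (hF : Differentiable ℝ F) (x d : Vec n) (s : ℝ) :
    HasDerivAt (fun s : ℝ => F (x + s • d)) (inner ℝ (gradient F (x + s • d)) d) s := by
  rw [inner_gradient_left]
  have hY : HasDerivAt (fun s : ℝ => x + s • d) d s := by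
    simpa using ((hasDerivAt_id s).smul_const d).const_add x
  exact (hF (x + s • d)).hasFDerivAt.comp_hasDerivAt s hY

/-- A gradient step of size `1 / (2L)`, where `L = L₀ + L₁ G`, lowers `F` by at least `G² / (4L)`.
As `F` can drop by at most `D`, `G² ≤ 4 D L`, which is linear in `G`. This frees the final constant
from any dependence on `x₀`. -/
theorem GeneralizedSmooth.norm_gradient_le {F : Vec n → ℝ} {L₀ L₁ D : ℝ} (hL₀ : 0 < L₀)
    (hL₁ : 0 ≤ L₁) (hF : GeneralizedSmooth F L₀ L₁) {x : Vec n} (hD : ∀ y, F x - F y ≤ D) :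
    ‖gradient F x‖ ≤ 4 * D * L₁ + 4 * D * L₀ + 1 := by
  set G := ‖gradient F x‖ with hG
  have hD0 : 0 ≤ D := by simpa using hD x
  by_cases hG1 : G ≤ 1
  · have : 0 ≤ 4 * D * L₁ + 4 * D * L₀ := by positivity
    linarith
  push Not at hG1
  set L := L₀ + L₁ * G with hL
  have hLpos : 0 < L := by have : 0 ≤ L₁ * G := by positivity
                           linarith
  set r : ℝ := (2 * L)⁻¹ with hr
  have hr0 : 0 < r := by positivity
  have hrL : 2 * (r * L) = 1 := by rw [hr]; field_simp
  set d : Vec n := -(r • gradient F x) with hd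
  have hdn : ‖d‖ = r * G := by rw [hd, norm_neg, norm_smul, Real.norm_of_nonneg hr0.le]
  have hLd : L₁ * ‖d‖ ≤ 1 := by
    rw [hdn]
    have : r * (L₁ * G) ≤ r * L := by
      refine mul_le_mul_of_nonneg_left ?_ hr0.le
      linarith
    nlinarith
  have hinner : inner ℝ (gradient F x) d = -(r * G ^ 2) := by
    rw [hd, inner_neg_right, inner_smul_right, real_inner_self_eq_norm_sq]
  -- Mean value inequality for the first-order Taylor remainder along the segment; the factor `1/2`
  -- is given up.
  have h := norm_image_sub_le_of_norm_deriv_le_segment_01'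
    (f := fun s : ℝ => F (x + s • d) - s * inner ℝ (gradient F x) d)
    (f' := fun s => inner ℝ (gradient F (x + s • d)) d - inner ℝ (gradient F x) d)
    (C := L * ‖d‖ ^ 2)
    (fun s _ => ((hasDerivAt_along hF.1 x d s).sub
      (by simpa using (hasDerivAt_id s).mul_const (inner ℝ (gradient F x) d))).hasDerivWithinAt)
    (fun s hs => by
      rw [← inner_sub_left]
      refine (norm_inner_le_norm _ _).trans ?_
      have hsd : ‖s • d‖ ≤ ‖d‖ := by
        rw [norm_smul, Real.norm_of_nonneg hs.1]
        exact mul_le_of_le_one_left (norm_nonneg _) hs.2.le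
      have h2 := hF.2 x (x + s • d) (by
        simpa using (mul_le_mul_of_nonneg_left hsd hL₁).trans hLd)
      rw [sub_add_cancel_left, norm_neg] at h2
      rw [norm_sub_rev, sq, ← mul_assoc]
      refine mul_le_mul_of_nonneg_right (h2.trans ?_) (norm_nonneg _)
      exact mul_le_mul_of_nonneg_left hsd hLpos.le)
  simp only [one_smul, zero_smul, add_zero, one_mul, zero_mul, sub_zero] at h
  have h3 := (le_abs_self _).trans h
  have h4 := hD (x + d)
  rw [hinner, hdn] at h3
  have h5 : L * (r * G) ^ 2 = r * G ^ 2 / 2 := by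
    calc L * (r * G) ^ 2 = (2 * (r * L)) * (r * G ^ 2) / 2 := by ring
      _ = _ := by rw [hrL]; ring
  have h6 : r * G ^ 2 ≤ 2 * D := by linarith
  have h7 : G ^ 2 ≤ 4 * D * L := by
    calc G ^ 2 = 2 * (r * L) * G ^ 2 := by rw [hrL, one_mul]
      _ = 2 * L * (r * G ^ 2) := by ring
      _ ≤ 2 * L * (2 * D) := by gcongr
      _ = _ := by ring
  have h8 : G * G ≤ (4 * D * L₁ + 4 * D * L₀) * G := by
    have : 4 * D * L₀ * 1 ≤ 4 * D * L₀ * G := by gcongr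
    rw [hL] at h7
    nlinarith
  have := le_of_mul_le_mul_right h8 (by linarith)
  linarith

theorem norm_gradient_sub_sub_hess_le {F : Vec n → ℝ} (hF : TwiceDifferentiable F) {x d : Vec n}
    {M : ℝ} (hM : 0 ≤ M) (h : ∀ y, ‖x - y‖ ≤ ‖d‖ → ‖hess F x - hess F y‖ ≤ M * ‖x - y‖) :
    ‖gradient F (x + d) - gradient F x - hess F x d‖ ≤ M * ‖d‖ ^ 2 := by
  have := (convex_closedBall x ‖d‖).norm_image_sub_le_of_norm_hasFDerivWithin_le'
    (f := gradient F) (f' := hess F) (φ := hess F x) (C := M * ‖d‖) (x := x) (y := x + d)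
    (fun y _ => (hF.2 y).hasFDerivAt.hasFDerivWithinAt)
    (fun y hy => by
      rw [mem_closedBall_iff_norm, norm_sub_rev] at hy
      rw [norm_sub_rev]
      exact (h y hy).trans (mul_le_mul_of_nonneg_left hy hM))
    (by simp) (by simp)
  simpa [sq, mul_assoc] using this

theorem le_quadratic_add_cubic {F : Vec n → ℝ} (hF : TwiceDifferentiable F) {x d : Vec n}
    {M : ℝ} (hM : 0 ≤ M) (h : ∀ y, ‖x - y‖ ≤ ‖d‖ → ‖hess F x - hess F y‖ ≤ M * ‖x - y‖) :
    F (x + d) ≤ F x + inner ℝ (gradient F x) d + (1 / 2) * inner ℝ d (hess F x d)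
      + M * ‖d‖ ^ 3 := by
  have hd2 : ∀ s : ℝ, HasDerivAt (fun s : ℝ => s * inner ℝ (gradient F x) d
      + s ^ 2 * ((1 / 2) * inner ℝ d (hess F x d)))
      (inner ℝ (gradient F x) d + s * inner ℝ d (hess F x d)) s := fun s => by
    refine (((hasDerivAt_id s).mul_const (inner ℝ (gradient F x) d)).add
      ((hasDerivAt_pow 2 s).mul_const ((1 / 2) * inner ℝ d (hess F x d)))).congr_deriv ?_
    simp
    ring
  have h := norm_image_sub_le_of_norm_deriv_le_segment_01'
    (f := fun s : ℝ => F (x + s • d) - (s * inner ℝ (gradient F x) d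
      + s ^ 2 * ((1 / 2) * inner ℝ d (hess F x d))))
    (f' := fun s => inner ℝ (gradient F (x + s • d)) d
      - (inner ℝ (gradient F x) d + s * inner ℝ d (hess F x d)))
    (C := M * ‖d‖ ^ 3)
    (fun s _ => ((hasDerivAt_along hF.1 x d s).sub (hd2 s)).hasDerivWithinAt)
    (fun s hs => by
      have hsd : ‖s • d‖ ≤ ‖d‖ := by
        rw [norm_smul, Real.norm_of_nonneg hs.1]
        exact mul_le_of_le_one_left (norm_nonneg _) hs.2.le
      have e : inner ℝ (gradient F (x + s • d)) d
          - (inner ℝ (gradient F x) d + s * inner ℝ d (hess F x d))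
          = inner ℝ (gradient F (x + s • d) - gradient F x - hess F x (s • d)) d := by
        rw [inner_sub_left, inner_sub_left, map_smul, inner_smul_left,
          real_inner_comm d (hess F x d)]
        simp only [conj_trivial]
        ring
      rw [e]
      refine (norm_inner_le_norm _ _).trans ?_
      rw [pow_succ, ← mul_assoc]
      refine mul_le_mul_of_nonneg_right ?_ (norm_nonneg _)
      refine (norm_gradient_sub_sub_hess_le hF hM fun y hy => h y (hy.trans hsd)).trans ?_
      gcongr)
  simp only [one_smul, zero_smul, add_zero, one_mul, zero_mul, one_pow] at h
  linarith [(le_abs_self _).trans h]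

end Hessian

/-! ### Global optimality conditions for the trust region subproblem. -/

section Multiplier

theorem model_sub_model {c : ℝ} {g : Vec n} {B : Vec n →L[ℝ] Vec n} (hB : IsSelfAdjoint B)
    (d e : Vec n) : model c g B e - model c g B d
      = inner ℝ (g + B d) (e - d) + (1 / 2) * inner ℝ (e - d) (B (e - d)) := by
  have hs := (ContinuousLinearMap.isSelfAdjoint_iff_isSymmetric.1 hB) d e
  simp only [ContinuousLinearMap.coe_coe] at hs
  have h2 := real_inner_comm e (B d)
  have h3 := real_inner_comm d (B d)
  simp only [model, map_sub, inner_sub_right, inner_sub_left, inner_add_left]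
  linarith

/-- Optimality conditions for the trust region subproblem. -/
theorem SolvesSubproblem.exists_multiplier {c Δ : ℝ} {g d : Vec n} {B : Vec n →L[ℝ] Vec n}
    (hB : IsSelfAdjoint B) (hΔ : 0 < Δ) (h : SolvesSubproblem c g B Δ d) :
    ∃ lam : ℝ, 0 ≤ lam ∧ g + B d = -(lam • d) ∧ lam * ‖d‖ = lam * Δ ∧
      ∀ v, 0 ≤ inner ℝ v (B v) + lam * ‖v‖ ^ 2 := by
  set w := g + B d with hw
  have hmin : ∀ e : Vec n, ‖e‖ ≤ Δ →
      0 ≤ inner ℝ w (e - d) + (1 / 2) * inner ℝ (e - d) (B (e - d)) := fun e he => by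
    rw [hw, ← model_sub_model (c := c) hB]
    linarith [h.2 e he]
  -- The model need not be convex, but the ball is: for a small enough `s`, a negative first-order
  -- term would outweigh the quadratic one at `d + s (e - d)`.
  have hfirst : ∀ e : Vec n, ‖e‖ ≤ Δ → 0 ≤ inner ℝ w (e - d) := fun e he => by
    by_contra hneg
    push Not at hneg
    set a := inner ℝ w (e - d)
    set q := inner ℝ (e - d) (B (e - d))
    have hq : 0 < |q| + 1 := by positivity
    set s : ℝ := min 1 (-a / (|q| + 1)) with hs
    have hs0 : 0 < s := lt_min zero_lt_one (div_pos (by linarith) hq)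
    have hs1 : s ≤ 1 := min_le_left _ _
    have hs2 : s * (|q| + 1) ≤ -a := by
      rw [← le_div_iff₀ hq]; exact min_le_right _ _
    have hball : ‖d + s • (e - d)‖ ≤ Δ := by
      have e1 : d + s • (e - d) = (1 - s) • d + s • e := by
        rw [smul_sub, sub_smul, one_smul]; abel
      rw [e1]
      refine (norm_add_le _ _).trans ?_
      rw [norm_smul, norm_smul, Real.norm_of_nonneg hs0.le, Real.norm_of_nonneg (by linarith)]
      nlinarith [h.1]
    have h1 := hmin _ hball
    rw [add_sub_cancel_left, map_smul, inner_smul_right, inner_smul_left, inner_smul_right] at h1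
    simp only [conj_trivial] at h1
    have h2 : 0 ≤ s * (a + 1 / 2 * (s * q)) := by
      refine h1.trans_eq ?_
      ring
    have h3 : 0 ≤ a + 1 / 2 * (s * q) := nonneg_of_mul_nonneg_right h2 hs0
    have h4 : s * q ≤ s * (|q| + 1) :=
      mul_le_mul_of_nonneg_left ((le_abs_self q).trans (by linarith)) hs0.le
    linarith
  set lam : ℝ := ‖w‖ / Δ with hlam
  have hlam0 : 0 ≤ lam := by positivity
  have hlamΔ : lam * Δ = ‖w‖ := div_mul_cancel₀ _ hΔ.ne'
  -- Obtained by testing the variational inequality at the boundary point opposite to `w`.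
  have hwd : inner ℝ w d ≤ -(‖w‖ * Δ) := by
    by_cases hw0 : w = 0
    · simp [hw0]
    have hwn : 0 < ‖w‖ := norm_pos_iff.2 hw0
    have h1 := hfirst (-((Δ / ‖w‖) • w)) (by
      rw [norm_neg, norm_smul, Real.norm_of_nonneg (by positivity), div_mul_cancel₀ _ hwn.ne'])
    rw [inner_sub_right, inner_neg_right, inner_smul_right, real_inner_self_eq_norm_sq] at h1
    have e : Δ / ‖w‖ * ‖w‖ ^ 2 = ‖w‖ * Δ := by field_simp
    linarith
  -- The equality case of Cauchy–Schwarz: expanding the square gives `‖w + lam d‖² ≤ 0`.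
  have hweq : w = -(lam • d) := by
    have h0 : ‖w + lam • d‖ ^ 2 ≤ 0 := by
      rw [norm_add_sq_real, inner_smul_right, norm_smul, Real.norm_of_nonneg hlam0]
      have h1 : lam * inner ℝ w d ≤ lam * -(‖w‖ * Δ) := mul_le_mul_of_nonneg_left hwd hlam0
      have h2 : lam * -(‖w‖ * Δ) = -‖w‖ ^ 2 := by
        rw [mul_neg, mul_left_comm, hlamΔ]; ring
      have h3 : lam * ‖d‖ ≤ ‖w‖ := by
        rw [← hlamΔ]; exact mul_le_mul_of_nonneg_left h.1 hlam0
      have h4 : (lam * ‖d‖) ^ 2 ≤ ‖w‖ ^ 2 := pow_le_pow_left₀ (by positivity) h3 2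
      linarith
    have h1 : ‖w + lam • d‖ = 0 := by
      have := le_antisymm h0 (sq_nonneg _)
      exact pow_eq_zero_iff two_ne_zero |>.1 this
    exact eq_neg_of_add_eq_zero_left (norm_eq_zero.1 h1)
  have hcomp : lam * ‖d‖ = lam * Δ := by
    rw [hlamΔ, hweq, norm_neg, norm_smul, Real.norm_of_nonneg hlam0]
  refine ⟨lam, hlam0, hweq, hcomp, ?_⟩
  -- In the interior the multiplier vanishes and every direction is admissible, so `B` itself is
  -- positive semidefinite.
  rcases lt_or_eq_of_le h.1 with hlt | hdΔ
  · intro v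
    have hl : lam = 0 := by
      by_contra hl
      exact hlt.ne (mul_left_cancel₀ hl hcomp)
    rw [hl, zero_smul, neg_zero] at hweq
    set τ : ℝ := (Δ - ‖d‖) / (‖v‖ + 1) with hτ
    have hτ0 : 0 < τ := div_pos (by linarith) (by positivity)
    have hτv : τ * (‖v‖ + 1) = Δ - ‖d‖ := div_mul_cancel₀ _ (by positivity)
    have h1 := hmin (d + τ • v) (by
      refine (norm_add_le _ _).trans ?_
      rw [norm_smul, Real.norm_of_nonneg hτ0.le]
      linarith)
    rw [add_sub_cancel_left, map_smul, inner_smul_right, inner_smul_left, inner_smul_right,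
      hweq, inner_zero_left] at h1
    simp only [conj_trivial] at h1
    have h2 : 0 ≤ τ ^ 2 * inner ℝ v (B v) := by linear_combination 2 * h1
    rw [hl, zero_mul, add_zero]
    exact nonneg_of_mul_nonneg_right h2 (by positivity)
  · have hd0 : 0 < ‖d‖ ^ 2 := by rw [hdΔ]; positivity
    have hne : ∀ v : Vec n, inner ℝ v d ≠ 0 → 0 ≤ inner ℝ v (B v) + lam * ‖v‖ ^ 2 := by
      intro v hv
      have hv0 : v ≠ 0 := by rintro rfl; simp at hv
      have hvn : 0 < ‖v‖ ^ 2 := by positivity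
      -- This `τ` reflects `d` in the hyperplane orthogonal to `v`. The reflected point stays on the
      -- sphere, and the model increases there by `τ² / 2` times the desired quantity.
      set τ : ℝ := -2 * inner ℝ v d / ‖v‖ ^ 2 with hτ
      have hτ0 : τ ≠ 0 := div_ne_zero (mul_ne_zero (by norm_num) hv) hvn.ne'
      have hτv : τ * ‖v‖ ^ 2 = -2 * inner ℝ v d := div_mul_cancel₀ _ hvn.ne'
      have hsq : ‖d + τ • v‖ ^ 2 = ‖d‖ ^ 2 := by
        rw [norm_add_sq_real, inner_smul_right, norm_smul, mul_pow, Real.norm_eq_abs, sq_abs,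
          real_inner_comm]
        linear_combination τ * hτv
      have hn : ‖d + τ • v‖ ≤ Δ := by
        rw [← hdΔ]
        exact le_of_pow_le_pow_left₀ two_ne_zero (norm_nonneg _) hsq.le
      have h1 := hmin _ hn
      rw [add_sub_cancel_left, map_smul, inner_smul_right, inner_smul_left, inner_smul_right,
        hweq, inner_neg_left, inner_smul_left, real_inner_comm v d] at h1
      simp only [conj_trivial] at h1
      have h2 : 0 ≤ τ ^ 2 * (inner ℝ v (B v) + lam * ‖v‖ ^ 2) := by
        linear_combination 2 * h1 - lam * τ * hτv
      exact nonneg_of_mul_nonneg_right h2 (by positivity)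
    intro v
    by_cases hv : inner ℝ v d = 0
    -- Directions orthogonal to `d` are limits of the directions `v + s d`, `s > 0`, already
    -- treated.
    · have hcont : Continuous fun s : ℝ =>
          inner ℝ (v + s • d) (B (v + s • d)) + lam * ‖v + s • d‖ ^ 2 := by fun_prop
      have ht := (hcont.tendsto 0).mono_left (nhdsWithin_le_nhds (s := Set.Ioi 0))
      simp only [zero_smul, add_zero] at ht
      refine ge_of_tendsto ht ?_
      filter_upwards [self_mem_nhdsWithin] with s hs
      refine hne _ ?_
      rw [inner_add_left, hv, inner_smul_left, real_inner_self_eq_norm_sq]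
      simp only [conj_trivial, zero_add]
      exact mul_ne_zero (ne_of_gt hs) hd0.ne'
    · exact hne v hv

end Multiplier

end TrustRegion

namespace TrustRegion

variable {n k : ℕ}

/-! ### The orthogonal projection onto the column space. -/

section Projection

theorem proj_isSelfAdjoint (V : Matrix (Fin n) (Fin k) ℝ) : IsSelfAdjoint (proj V) := by
  have h : IsSelfAdjoint (V * V.transpose) := by
    rw [isSelfAdjoint_iff, Matrix.star_eq_conjTranspose]
    simp [Matrix.conjTranspose_eq_transpose_of_trivial]
  exact h.map (Matrix.toEuclideanCLM (n := Fin n) (𝕜 := ℝ))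

theorem inner_proj (V : Matrix (Fin n) (Fin k) ℝ) (v w : Vec n) :
    inner ℝ (proj V v) w = inner ℝ v (proj V w) :=
  (ContinuousLinearMap.isSelfAdjoint_iff_isSymmetric.1 (proj_isSelfAdjoint V)) v w

theorem proj_proj {V : Matrix (Fin n) (Fin k) ℝ} (hV : V.transpose * V = 1) (v : Vec n) :
    proj V (proj V v) = proj V v := by
  have h : proj V * proj V = proj V := by
    rw [proj, ← map_mul, Matrix.mul_assoc, ← Matrix.mul_assoc V.transpose, hV, Matrix.one_mul]
  rw [← mul_apply_eq_comp, h]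

theorem norm_proj_apply_le {V : Matrix (Fin n) (Fin k) ℝ} (hV : V.transpose * V = 1) (v : Vec n) :
    ‖proj V v‖ ≤ ‖v‖ := by
  have h1 : ‖proj V v‖ * ‖proj V v‖ ≤ ‖v‖ * ‖proj V v‖ := by
    rw [← sq, ← real_inner_self_eq_norm_sq, inner_proj, proj_proj hV]
    exact real_inner_le_norm _ _
  rcases eq_or_ne ‖proj V v‖ 0 with h | h
  · rw [h]; positivity
  · exact le_of_mul_le_mul_right h1 (lt_of_le_of_ne (norm_nonneg _) h.symm)

theorem projected_isSelfAdjoint (V : Matrix (Fin n) (Fin k) ℝ) {A : Vec n →L[ℝ] Vec n}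
    (hA : IsSelfAdjoint A) : IsSelfAdjoint (projected V A) := by
  have hs := ContinuousLinearMap.isSelfAdjoint_iff_isSymmetric.1 hA
  rw [ContinuousLinearMap.isSelfAdjoint_iff_isSymmetric]
  intro v w
  have := hs (proj V v) (proj V w)
  simp only [ContinuousLinearMap.coe_coe] at this
  simp only [projected, ContinuousLinearMap.coe_coe, ContinuousLinearMap.comp_apply]
  rw [inner_proj, this, inner_proj]

theorem projected_sub (V : Matrix (Fin n) (Fin k) ℝ) (A B : Vec n →L[ℝ] Vec n) :
    projected V (A - B) = projected V A - projected V B := by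
  ext1 v
  simp [projected]

theorem norm_projected_le {V : Matrix (Fin n) (Fin k) ℝ} (hV : V.transpose * V = 1)
    (A : Vec n →L[ℝ] Vec n) : ‖projected V A‖ ≤ ‖A‖ := by
  refine ContinuousLinearMap.opNorm_le_bound _ (norm_nonneg _) fun v => ?_
  simp only [projected, ContinuousLinearMap.comp_apply]
  refine (norm_proj_apply_le hV _).trans ((A.le_opNorm _).trans ?_)
  exact mul_le_mul_of_nonneg_left (norm_proj_apply_le hV v) (norm_nonneg _)

end Projection

/-! ### Variational bounds and measurability of the smallest eigenvalue. -/

section LambdaMin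

variable {A B : Vec n →L[ℝ] Vec n}

theorem mem_spectrum_iff_exists_eigenvector {μ : ℝ} :
    μ ∈ spectrum ℝ A ↔ ∃ v, v ≠ 0 ∧ A v = μ • v := by
  rw [ContinuousLinearMap.spectrum_eq, ← Module.End.hasEigenvalue_iff_mem_spectrum]
  constructor
  · intro h
    obtain ⟨v, hv⟩ := h.exists_hasEigenvector
    exact ⟨v, hv.2, hv.apply_eq_smul⟩
  · rintro ⟨v, hv0, hv⟩
    exact Module.End.hasEigenvalue_of_hasEigenvector
      ⟨Module.End.mem_eigenspace_iff.2 hv, hv0⟩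

theorem abs_le_opNorm_of_mem_spectrum {μ : ℝ} (h : μ ∈ spectrum ℝ A) : |μ| ≤ ‖A‖ := by
  obtain ⟨v, hv0, hv⟩ := mem_spectrum_iff_exists_eigenvector.1 h
  have h1 := A.le_opNorm v
  rw [hv, norm_smul] at h1
  exact le_of_mul_le_mul_right h1 (norm_pos_iff.2 hv0)

theorem bddBelow_spectrum (A : Vec n →L[ℝ] Vec n) : BddBelow (spectrum ℝ A) :=
  ⟨-‖A‖, fun _ hμ => neg_le_of_abs_le (abs_le_opNorm_of_mem_spectrum hμ)⟩

/-- Positivity of `n` matters here: the infimum defining `lambdaMin` would otherwise be that of the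
empty set. -/
theorem spectrum_nonempty (hn : 0 < n) (hA : IsSelfAdjoint A) : (spectrum ℝ A).Nonempty := by
  obtain ⟨b, l, hb⟩ := exists_orthonormal_eigenbasis hA
  have hd : 0 < Module.finrank ℝ (Vec n) := by simpa using hn
  refine ⟨l ⟨0, hd⟩, mem_spectrum_iff_exists_eigenvector.2 ⟨b ⟨0, hd⟩, ?_, ?_⟩⟩
  · exact b.orthonormal.ne_zero _
  · simpa using hb 1 ⟨0, hd⟩

theorem le_lambdaMin (hn : 0 < n) (hA : IsSelfAdjoint A) {c : ℝ}
    (h : ∀ v, c * ‖v‖ ^ 2 ≤ inner ℝ v (A v)) : c ≤ lambdaMin A := by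
  refine le_csInf (spectrum_nonempty hn hA) fun μ hμ => ?_
  obtain ⟨v, hv0, hv⟩ := mem_spectrum_iff_exists_eigenvector.1 hμ
  have h1 := h v
  rw [hv, inner_smul_right, real_inner_self_eq_norm_sq] at h1
  exact le_of_mul_le_mul_right h1 (by positivity)

theorem lambdaMin_mul_le (hA : IsSelfAdjoint A) (v : Vec n) :
    lambdaMin A * ‖v‖ ^ 2 ≤ inner ℝ v (A v) := by
  obtain ⟨b, l, hb⟩ := exists_orthonormal_eigenbasis hA
  have e : inner ℝ v (A v) = ∑ i, l i * inner ℝ (b i) v ^ 2 := by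
    have h1 : A v = ∑ i, (inner ℝ (b i) v * l i) • b i := by
      conv_lhs => rw [← b.sum_repr' v]
      rw [map_sum]
      refine Finset.sum_congr rfl fun i _ => ?_
      have := hb 1 i
      simp only [pow_one] at this
      rw [map_smul, this, smul_smul]
    rw [h1, inner_sum]
    refine Finset.sum_congr rfl fun i _ => ?_
    rw [inner_smul_right, real_inner_comm]
    ring
  rw [e, ← b.sum_sq_norm_inner_right v, Finset.mul_sum]
  refine Finset.sum_le_sum fun i _ => ?_
  rw [Real.norm_eq_abs, sq_abs]
  refine mul_le_mul_of_nonneg_right ?_ (sq_nonneg _)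
  refine csInf_le (bddBelow_spectrum A) (mem_spectrum_iff_exists_eigenvector.2 ⟨b i, ?_, ?_⟩)
  · exact b.orthonormal.ne_zero _
  · simpa using hb 1 i

theorem abs_lambdaMin_le (hn : 0 < n) (hA : IsSelfAdjoint A) : |lambdaMin A| ≤ ‖A‖ := by
  rw [abs_le]
  constructor
  · exact le_csInf (spectrum_nonempty hn hA) fun μ hμ =>
      neg_le_of_abs_le (abs_le_opNorm_of_mem_spectrum hμ)
  · obtain ⟨μ, hμ⟩ := spectrum_nonempty hn hA
    exact (csInf_le (bddBelow_spectrum A) hμ).trans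
      (le_of_abs_le (abs_le_opNorm_of_mem_spectrum hμ))

theorem abs_inner_apply_le (A : Vec n →L[ℝ] Vec n) (v : Vec n) :
    |inner ℝ v (A v)| ≤ ‖A‖ * ‖v‖ ^ 2 := by
  refine (abs_real_inner_le_norm _ _).trans ?_
  have := mul_le_mul_of_nonneg_left (A.le_opNorm v) (norm_nonneg v)
  linarith

theorem lambdaMin_sub_norm_le (hn : 0 < n) (hA : IsSelfAdjoint A) (hB : IsSelfAdjoint B) :
    lambdaMin A - ‖A - B‖ ≤ lambdaMin B := by
  refine le_lambdaMin hn hB fun v => ?_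
  have h1 := lambdaMin_mul_le hA v
  have h2 := le_of_abs_le (abs_inner_apply_le (A - B) v)
  rw [sub_apply, inner_sub_right] at h2
  linarith

/-- On self-adjoint operators `lambdaMin` is 1-Lipschitz for the operator norm, and a real Lipschitz
function extends to the whole space. The extension yields measurability. -/
theorem exists_continuous_eq_lambdaMin (hn : 0 < n) : ∃ g : (Vec n →L[ℝ] Vec n) → ℝ,
    Continuous g ∧ ∀ A, IsSelfAdjoint A → lambdaMin A = g A := by
  have h : LipschitzOnWith 1 (lambdaMin (n := n)) {A | IsSelfAdjoint A} := by
    refine LipschitzOnWith.of_dist_le_mul fun A hA B hB => ?_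
    have h1 := lambdaMin_sub_norm_le hn hA hB
    have h2 := lambdaMin_sub_norm_le hn hB hA
    rw [norm_sub_rev] at h2
    rw [Real.dist_eq, NNReal.coe_one, one_mul, dist_eq_norm, abs_le]
    constructor <;> linarith
  obtain ⟨g, hg, he⟩ := h.extend_real
  exact ⟨g, hg.continuous, fun A hA => he hA⟩

theorem measurable_lambdaMin {Ω : Type*} [MeasurableSpace Ω] (hn : 0 < n)
    {A : Ω → Vec n →L[ℝ] Vec n} (hA : Measurable A)
    (hsa : ∀ ω, IsSelfAdjoint (A ω)) : Measurable fun ω => lambdaMin (A ω) := by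
  obtain ⟨g, hg, he⟩ := exists_continuous_eq_lambdaMin hn
  have e : (fun ω => lambdaMin (A ω)) = fun ω => g (A ω) := funext fun ω => he _ (hsa ω)
  rw [e]
  exact hg.measurable.comp hA

end LambdaMin

/-! ### Deterministic analysis of one iteration. -/

section Step

/-- Decrease of the objective over one step of the trust region method. -/
theorem step_decrease (hn : 0 < n) {F : Vec n → ℝ} (hF : TwiceDifferentiable F) {x d g : Vec n}
    {Δ M R c : ℝ} (hΔ : 0 < Δ) (hM : 0 ≤ M) (hR : 0 ≤ R)
    (hsm : ∀ y, ‖x - y‖ ≤ Δ → ‖hess F x - hess F y‖ ≤ M * ‖x - y‖)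
    {H : Vec n →L[ℝ] Vec n} (hH : IsSelfAdjoint H) {V : Matrix (Fin n) (Fin k) ℝ}
    (hV : V.transpose * V = 1) (hd : SolvesSubproblem c g (projected V H) Δ d)
    (hin : ‖(hess F x - projected V (hess F x)) d‖ ≤ R * ‖d‖ ^ 2) :
    1 / 2 * Δ * ‖gradient F (x + d)‖ ≤ F x - F (x + d)
      + 2 * (Δ * ‖g - gradient F x‖ + Δ ^ 2 * ‖H - hess F x‖ + Δ ^ 3 * (M + R)) ∧
    1 / 2 * Δ ^ 2 * -lambdaMin (projected V (hess F (x + d))) ≤ F x - F (x + d)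
      + 2 * (Δ * ‖g - gradient F x‖ + Δ ^ 2 * ‖H - hess F x‖ + Δ ^ 3 * (M + R)) := by
  set eg := ‖g - gradient F x‖ with heg
  set eH := ‖H - hess F x‖ with heH
  have heg0 : 0 ≤ eg := norm_nonneg _
  have heH0 : 0 ≤ eH := norm_nonneg _
  set B := projected V H with hBdef
  have hB : IsSelfAdjoint B := projected_isSelfAdjoint V hH
  obtain ⟨lam, hlam0, hw, hcomp, hpsd⟩ := hd.exists_multiplier hB hΔ
  have hdn := hd.1
  have hd0 := norm_nonneg d
  have hd2 : ‖d‖ ^ 2 ≤ Δ ^ 2 := pow_le_pow_left₀ hd0 hdn 2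
  have hd3 : ‖d‖ ^ 3 ≤ Δ ^ 3 := pow_le_pow_left₀ hd0 hdn 3
  have hlamsq : lam * ‖d‖ ^ 2 = lam * Δ ^ 2 := by
    calc lam * ‖d‖ ^ 2 = (lam * ‖d‖) * ‖d‖ := by ring
      _ = (lam * ‖d‖) * Δ := by rw [hcomp]; linear_combination Δ * hcomp
      _ = _ := by rw [hcomp]; ring
  -- the Hessian error on the step
  have hBerr : ∀ v, ‖(projected V (hess F x) - B) v‖ ≤ eH * ‖v‖ := fun v => by
    rw [hBdef, ← projected_sub]
    refine (ContinuousLinearMap.le_opNorm _ _).trans ?_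
    refine mul_le_mul_of_nonneg_right ((norm_projected_le hV _).trans ?_) (norm_nonneg _)
    rw [norm_sub_rev]
  have hHB : ‖(hess F x - B) d‖ ≤ R * Δ ^ 2 + eH * Δ := by
    have e : (hess F x - B) d
        = (hess F x - projected V (hess F x)) d + (projected V (hess F x) - B) d := by
      simp
    rw [e]
    refine (norm_add_le _ _).trans (add_le_add (hin.trans ?_) ((hBerr d).trans ?_))
    · exact mul_le_mul_of_nonneg_left hd2 hR
    · exact mul_le_mul_of_nonneg_left hdn heH0
  have hloc : ∀ y, ‖x - y‖ ≤ ‖d‖ → ‖hess F x - hess F y‖ ≤ M * ‖x - y‖ :=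
    fun y hy => hsm y (hy.trans hdn)
  -- Since `g + B d = -lam d`, the model change is `-lam ‖d‖² - dᵀ B d / 2`, and `B + lam ≥ 0` makes
  -- it at most `-lam ‖d‖² / 2`. Complementarity turns `‖d‖` into `Δ`.
  have hdec : F (x + d) ≤ F x - 1 / 2 * lam * Δ ^ 2 + Δ * eg
      + 1 / 2 * (R * Δ ^ 3 + eH * Δ ^ 2) + M * Δ ^ 3 := by
    have h1 := le_quadratic_add_cubic hF hM hloc
    have h2 : inner ℝ (gradient F x) d + 1 / 2 * inner ℝ d (hess F x d)
        = (inner ℝ (g + B d) d - 1 / 2 * inner ℝ d (B d)) - inner ℝ (g - gradient F x) d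
          + 1 / 2 * inner ℝ d ((hess F x - B) d) := by
      rw [sub_apply, inner_sub_right, inner_sub_left, inner_add_left, real_inner_comm d (B d)]
      ring
    have h3 : inner ℝ (g + B d) d = -(lam * ‖d‖ ^ 2) := by
      rw [hw, inner_neg_left, inner_smul_left, real_inner_self_eq_norm_sq]
      simp
    have h4 := hpsd d
    have h5 : -inner ℝ (g - gradient F x) d ≤ Δ * eg := by
      have a := neg_le_of_abs_le (abs_real_inner_le_norm (g - gradient F x) d)
      have b : eg * ‖d‖ ≤ eg * Δ := mul_le_mul_of_nonneg_left hdn heg0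
      linarith
    have h6 : inner ℝ d ((hess F x - B) d) ≤ R * Δ ^ 3 + eH * Δ ^ 2 := by
      have a := real_inner_le_norm d ((hess F x - B) d)
      have b : ‖d‖ * ‖(hess F x - B) d‖ ≤ Δ * (R * Δ ^ 2 + eH * Δ) := by gcongr
      linarith
    have h7 : M * ‖d‖ ^ 3 ≤ M * Δ ^ 3 := mul_le_mul_of_nonneg_left hd3 hM
    linarith
  constructor
  -- The new gradient splits into Taylor remainder, gradient error, Hessian error on `d`, and `g + B
  -- d`, of norm `lam Δ`. Multiplied by `Δ / 2`, the last is paid for by the decrease.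
  · have hg : ‖gradient F (x + d)‖ ≤ M * Δ ^ 2 + eg + (R * Δ ^ 2 + eH * Δ) + lam * Δ := by
      have e : gradient F (x + d) = (gradient F (x + d) - gradient F x - hess F x d)
          + -(g - gradient F x) + (hess F x - B) d + (g + B d) := by
        rw [sub_apply]; abel
      have h1 := norm_gradient_sub_sub_hess_le hF hM hloc
      have h2 : M * ‖d‖ ^ 2 ≤ M * Δ ^ 2 := mul_le_mul_of_nonneg_left hd2 hM
      have h3 : ‖g + B d‖ = lam * Δ := by
        rw [hw, norm_neg, norm_smul, Real.norm_of_nonneg hlam0, hcomp]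
      rw [e]
      refine (norm_add_le _ _).trans (add_le_add ((norm_add_le _ _).trans
        (add_le_add ((norm_add_le _ _).trans (add_le_add (h1.trans h2) ?_)) hHB)) h3.le)
      rw [norm_neg]
    have h2 := mul_le_mul_of_nonneg_left hg (by positivity : 0 ≤ 1 / 2 * Δ)
    have : 0 ≤ Δ * eg := by positivity
    have : 0 ≤ Δ ^ 2 * eH := by positivity
    have : 0 ≤ Δ ^ 3 * M := by positivity
    have : 0 ≤ Δ ^ 3 * R := by positivity
    linarith
  -- `B + lam ≥ 0` passes to the new projected Hessian at the cost of the sampling error and the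
  -- variation of the Hessian over the step.
  · have hl : -lam - eH - M * Δ ≤ lambdaMin (projected V (hess F (x + d))) := by
      refine le_lambdaMin hn (projected_isSelfAdjoint V (hess_isSymmetric hF _)) fun v => ?_
      have h1 := hpsd v
      have h2 : |inner ℝ v ((projected V (hess F x) - B) v)| ≤ eH * ‖v‖ ^ 2 := by
        refine (abs_real_inner_le_norm _ _).trans ?_
        have := mul_le_mul_of_nonneg_left (hBerr v) (norm_nonneg v)
        linarith
      have h3 : |inner ℝ v (projected V (hess F x - hess F (x + d)) v)| ≤ M * Δ * ‖v‖ ^ 2 := by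
        refine (abs_inner_apply_le _ _).trans (mul_le_mul_of_nonneg_right ?_ (sq_nonneg _))
        refine (norm_projected_le hV _).trans ((hsm _ (by simpa using hdn)).trans ?_)
        exact mul_le_mul_of_nonneg_left (by simpa using hdn) hM
      have h4 := neg_le_of_abs_le h2
      have h5 := le_of_abs_le h3
      rw [sub_apply, inner_sub_right] at h4
      rw [projected_sub, sub_apply, inner_sub_right] at h5
      linarith
    have h2 := mul_le_mul_of_nonneg_left hl (by positivity : 0 ≤ 1 / 2 * Δ ^ 2)
    have : 0 ≤ Δ * eg := by positivity
    have : 0 ≤ Δ ^ 2 * eH := by positivity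
    have : 0 ≤ Δ ^ 3 * M := by positivity
    have : 0 ≤ Δ ^ 3 * R := by positivity
    linarith

end Step

/-! ### Joint measurability of derivatives in the point and the sample. -/

section Measurability

/-- The derivative is the pointwise limit of the jointly measurable quotients `j (G(x + v/j) -
G(x))`. -/
theorem measurable_fderiv_apply_uncurry [MeasurableSpace Ξ] {E : Type*} [NormedAddCommGroup E]
    [NormedSpace ℝ E] [MeasurableSpace E] [BorelSpace E] [SecondCountableTopology E]
    {G : Vec n → Ξ → E} (hG : Measurable (Function.uncurry G))
    (hd : ∀ ξ, Differentiable ℝ fun x => G x ξ) (v : Vec n) :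
    Measurable fun p : Vec n × Ξ => fderiv ℝ (fun y => G y p.2) p.1 v := by
  refine measurable_of_tendsto_metrizable (f := fun (j : ℕ) (p : Vec n × Ξ) =>
    ((j : ℝ) • (G (p.1 + (j : ℝ)⁻¹ • v) p.2 - G p.1 p.2))) (fun j => ?_) ?_
  · have h1 : Measurable fun p : Vec n × Ξ => (p.1 + (j : ℝ)⁻¹ • v, p.2) := by fun_prop
    exact ((hG.comp h1).sub hG).const_smul (j : ℝ)
  · rw [tendsto_pi_nhds]
    intro p
    refine (hd p.2 p.1).hasFDerivAt.lim v ?_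
    simpa using tendsto_natCast_atTop_atTop

theorem measurable_gradient_uncurry [MeasurableSpace Ξ] {f : Vec n → Ξ → ℝ}
    (hf : Measurable (Function.uncurry f)) (hd : ∀ ξ, Differentiable ℝ fun x => f x ξ) :
    Measurable (Function.uncurry fun x ξ => gradient (fun y => f y ξ) x) := by
  have e : (Function.uncurry fun x ξ => gradient (fun y => f y ξ) x) = fun p : Vec n × Ξ =>
      ∑ i, fderiv ℝ (fun y => f y p.2) p.1 (EuclideanSpace.basisFun (Fin n) ℝ i) •
        EuclideanSpace.basisFun (Fin n) ℝ i := by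
    funext p
    rw [← (EuclideanSpace.basisFun (Fin n) ℝ).sum_repr' (Function.uncurry _ p)]
    refine Finset.sum_congr rfl fun i _ => ?_
    rw [← inner_gradient_left, real_inner_comm]
    rfl
  rw [e]
  exact Finset.measurable_sum _ fun i _ => (measurable_fderiv_apply_uncurry hf hd _).smul_const _

theorem measurable_clm_of_apply {α : Type*} [MeasurableSpace α] {A : α → Vec n →L[ℝ] Vec n}
    (h : ∀ v, Measurable fun a => A a v) : Measurable A := by
  have e : A = fun a => ∑ i, ContinuousLinearMap.smulRightL ℝ (Vec n) (Vec n)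
      (innerSL ℝ (EuclideanSpace.basisFun (Fin n) ℝ i)) (A a (EuclideanSpace.basisFun (Fin n) ℝ i)) := by
    funext a
    ext1 v
    conv_lhs => rw [← (EuclideanSpace.basisFun (Fin n) ℝ).sum_repr' v, map_sum]
    rw [sum_apply]
    refine Finset.sum_congr rfl fun i _ => ?_
    rw [map_smul]
    rfl
  rw [e]
  exact Finset.measurable_sum _ fun i _ =>
    (ContinuousLinearMap.continuous _).measurable.comp (h _)

theorem measurable_hess_uncurry [MeasurableSpace Ξ] {f : Vec n → Ξ → ℝ}
    (hf : Measurable (Function.uncurry f)) (hd : ∀ ξ, TwiceDifferentiable fun x => f x ξ) :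
    Measurable (Function.uncurry fun x ξ => hess (fun y => f y ξ) x) :=
  measurable_clm_of_apply fun v =>
    measurable_fderiv_apply_uncurry (measurable_gradient_uncurry hf fun ξ => (hd ξ).1)
      (fun ξ => (hd ξ).2) v

theorem measurable_proj [MeasurableSpace Ω] {V : Ω → Matrix (Fin n) (Fin k) ℝ}
    (hV : ∀ i j, Measurable fun ω => V ω i j) : Measurable fun ω => proj (V ω) := by
  refine measurable_clm_of_apply fun v => ?_
  have e : (fun ω => proj (V ω) v)
      = fun ω => WithLp.toLp 2 ((V ω * (V ω).transpose).mulVec (WithLp.ofLp v)) := rfl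
  rw [e]
  refine (WithLp.measurable_toLp 2 _).comp (measurable_pi_lambda _ fun i => ?_)
  simp only [Matrix.mulVec, dotProduct, Matrix.mul_apply, Matrix.transpose_apply]
  exact Finset.measurable_sum _ fun j _ => (Finset.measurable_sum _ fun l _ =>
    (hV i l).mul (hV j l)).mul_const _

theorem measurable_projected [MeasurableSpace Ω] {V : Ω → Matrix (Fin n) (Fin k) ℝ}
    (hV : ∀ i j, Measurable fun ω => V ω i j) {A : Ω → Vec n →L[ℝ] Vec n} (hA : Measurable A) :
    Measurable fun ω => projected (V ω) (A ω) := by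
  have h : Measurable fun ω => proj (V ω) * (A ω * proj (V ω)) :=
    (measurable_proj hV).mul (hA.mul (measurable_proj hV))
  exact h

end Measurability

/-! ### Derivatives of batch functions. -/

section BatchDerivatives

theorem hasGradientAt_batch {m : ℕ} {f : Vec n → Ξ → ℝ} (hd : ∀ ξ, Differentiable ℝ fun x => f x ξ)
    (S : Fin m → Ξ) (x : Vec n) :
    HasGradientAt (batch f S) ((m : ℝ)⁻¹ • ∑ i, gradient (fun y => f y (S i)) x) x := by
  rw [hasGradientAt_iff_hasFDerivAt, map_smul, map_sum]
  refine HasFDerivAt.const_mul ?_ _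
  refine HasFDerivAt.fun_sum fun i _ => ?_
  exact ((hd (S i)) x).hasGradientAt.hasFDerivAt

theorem gradient_batch {m : ℕ} {f : Vec n → Ξ → ℝ} (hd : ∀ ξ, Differentiable ℝ fun x => f x ξ)
    (S : Fin m → Ξ) :
    gradient (batch f S) = fun x => (m : ℝ)⁻¹ • ∑ i, gradient (fun y => f y (S i)) x :=
  funext fun x => (hasGradientAt_batch hd S x).gradient

theorem hess_batch {m : ℕ} {f : Vec n → Ξ → ℝ} (hd : ∀ ξ, TwiceDifferentiable fun x => f x ξ)
    (S : Fin m → Ξ) (x : Vec n) :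
    hess (batch f S) x = (m : ℝ)⁻¹ • ∑ i, hess (fun y => f y (S i)) x := by
  rw [hess, gradient_batch fun ξ => (hd ξ).1]
  refine HasFDerivAt.fderiv ?_
  refine HasFDerivAt.const_smul ?_ (m : ℝ)⁻¹
  exact HasFDerivAt.fun_sum fun i _ => ((hd (S i)).2 x).hasFDerivAt

theorem hess_batch_isSelfAdjoint {m : ℕ} {f : Vec n → Ξ → ℝ}
    (hd : ∀ ξ, TwiceDifferentiable fun x => f x ξ) (S : Fin m → Ξ) (x : Vec n) :
    IsSelfAdjoint (hess (batch f S) x) := by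
  refine hess_isSymmetric ⟨fun y => (hasGradientAt_batch (fun ξ => (hd ξ).1) S y).differentiableAt,
    ?_⟩ x
  rw [gradient_batch fun ξ => (hd ξ).1]
  exact Differentiable.const_smul (Differentiable.fun_sum fun i _ => (hd (S i)).2) (m : ℝ)⁻¹

theorem measurable_gradient_batch [MeasurableSpace Ξ] {m : ℕ} {f : Vec n → Ξ → ℝ}
    (hf : Measurable (Function.uncurry f)) (hd : ∀ ξ, Differentiable ℝ fun x => f x ξ) :
    Measurable fun p : Vec n × (Fin m → Ξ) => gradient (batch f p.2) p.1 := by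
  simp only [gradient_batch hd]
  refine Measurable.const_smul (Finset.measurable_sum _ fun i _ => ?_) (m : ℝ)⁻¹
  have h1 : Measurable fun p : Vec n × (Fin m → Ξ) => (p.1, p.2 i) := by fun_prop
  exact (measurable_gradient_uncurry hf hd).comp h1

theorem measurable_hess_batch [MeasurableSpace Ξ] {m : ℕ} {f : Vec n → Ξ → ℝ}
    (hf : Measurable (Function.uncurry f)) (hd : ∀ ξ, TwiceDifferentiable fun x => f x ξ) :
    Measurable fun p : Vec n × (Fin m → Ξ) => hess (batch f p.2) p.1 := by
  simp only [hess_batch hd]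
  refine Measurable.const_smul (Finset.measurable_sum _ fun i _ => ?_) (m : ℝ)⁻¹
  have h1 : Measurable fun p : Vec n × (Fin m → Ξ) => (p.1, p.2 i) := by fun_prop
  exact (measurable_hess_uncurry hf hd).comp h1

end BatchDerivatives

/-! ### Expected errors of the gradient and Hessian estimates. -/

section Oracle

/-- Freshness of the samples, as a product law, lets an estimate at each fixed point be used at the
random iterate. -/
theorem lintegral_comp_le_of_indep [MeasurableSpace Ξ] [MeasurableSpace Ω] {P : Measure Ξ}
    [IsProbabilityMeasure P] {μ : Measure Ω} {m : ℕ} {X : Ω → Vec n} {S : Ω → Fin m → Ξ}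
    (hX : Measurable X) (hS : Measurable S)
    (hlaw : μ.map (fun ω => (X ω, S ω)) = (μ.map X).prod (Measure.pi fun _ => P))
    {ψ : Vec n × (Fin m → Ξ) → ENNReal} (hψ : Measurable ψ) {b : Vec n → ENNReal}
    (hb : Measurable b) (h : ∀ x, ∫⁻ s, ψ (x, s) ∂(Measure.pi fun _ => P) ≤ b x) :
    ∫⁻ ω, ψ (X ω, S ω) ∂μ ≤ ∫⁻ ω, b (X ω) ∂μ := by
  rw [← lintegral_map hψ (hX.prodMk hS), hlaw, lintegral_prod _ hψ.aemeasurable,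
    ← lintegral_map hb hX]
  exact lintegral_mono h

theorem integrable_and_integral_le_of_lintegral_le [MeasurableSpace Ω] {μ : Measure Ω}
    {e b : Ω → ℝ} (he : Measurable e) (he0 : ∀ ω, 0 ≤ e ω) (hb : Integrable b μ)
    (hb0 : ∀ ω, 0 ≤ b ω)
    (h : ∫⁻ ω, ENNReal.ofReal (e ω) ∂μ ≤ ∫⁻ ω, ENNReal.ofReal (b ω) ∂μ) :
    Integrable e μ ∧ ∫ ω, e ω ∂μ ≤ ∫ ω, b ω ∂μ := by
  rw [← ofReal_integral_eq_lintegral_ofReal hb (Filter.Eventually.of_forall hb0)] at h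
  have hi : Integrable e μ := by
    refine ⟨he.aestronglyMeasurable, ?_⟩
    rw [hasFiniteIntegral_iff_ofReal (Filter.Eventually.of_forall he0)]
    exact h.trans_lt ENNReal.ofReal_lt_top
  refine ⟨hi, ?_⟩
  rw [← ofReal_integral_eq_lintegral_ofReal hi (Filter.Eventually.of_forall he0)] at h
  exact (ENNReal.ofReal_le_ofReal_iff (integral_nonneg hb0)).1 h

theorem lintegral_gradient_error_le [MeasurableSpace Ξ] {P : Measure Ξ} [IsProbabilityMeasure P]
    {f : Vec n → Ξ → ℝ} (hf : Measurable (Function.uncurry f))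
    (hd : ∀ ξ, Differentiable ℝ fun x => f x ξ) {G₀ G₁ : ℝ} (hG₀ : 0 ≤ G₀) (hG₁ : 0 ≤ G₁)
    (hvar : BoundedGradientVariance P f G₀ G₁) {m : ℕ} {ε : ℝ} (hε : 0 < ε)
    (hm : (ε ^ 2)⁻¹ ≤ m) (x : Vec n) :
    ∫⁻ s : Fin m → Ξ, ENNReal.ofReal ‖gradient (batch f s) x - gradient (objective P f) x‖
        ∂(Measure.pi fun _ => P)
      ≤ ENNReal.ofReal (ε * (1 + G₀ + G₁ * ‖gradient (objective P f) x‖)) := by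
  obtain ⟨h1, h2, h3, h4⟩ := hvar x
  have hm0 : (0 : ℝ) < m := lt_of_lt_of_le (by positivity) hm
  have hZ : Measurable fun ξ => gradient (fun y => f y ξ) x :=
    (measurable_gradient_uncurry hf hd).comp measurable_prodMk_left
  simp only [gradient_batch hd]
  refine lintegral_norm_batch_vec_sub_le P hZ h1 h2 h3 h4 (by exact_mod_cast hm0)
    (by positivity) ?_
  set G := ‖gradient (objective P f) x‖
  have hG : 0 ≤ G := norm_nonneg _
  have h5 : 1 ≤ m * ε ^ 2 := by
    have := mul_le_mul_of_nonneg_right hm (sq_nonneg ε)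
    rwa [inv_mul_cancel₀ (by positivity)] at this
  have h6 : G₀ ^ 2 + G₁ ^ 2 * G ^ 2 ≤ (1 + G₀ + G₁ * G) ^ 2 := by
    have : 0 ≤ G₁ * G := by positivity
    nlinarith [mul_nonneg hG₀ this]
  calc G₀ ^ 2 + G₁ ^ 2 * G ^ 2 ≤ 1 * (1 + G₀ + G₁ * G) ^ 2 := by linarith
    _ ≤ (m * ε ^ 2) * (1 + G₀ + G₁ * G) ^ 2 := by gcongr
    _ = _ := by ring

/-- The summand `1` on the right pays for the smoothing of the spectral norm: `1 + K₀² + K₁² G² ≤ (1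
+ K₀ + K₁ G)²`. -/
theorem lintegral_hess_error_le (hn : 2 ≤ n) [MeasurableSpace Ξ] {P : Measure Ξ}
    [IsProbabilityMeasure P]
    {f : Vec n → Ξ → ℝ} (hf : Measurable (Function.uncurry f))
    (hd : ∀ ξ, TwiceDifferentiable fun x => f x ξ)
    (hF : TwiceDifferentiable (objective P f)) {K₀ K₁ : ℝ} (hK₀ : 0 ≤ K₀) (hK₁ : 0 ≤ K₁)
    (hvar : BoundedHessianVariance P f K₀ K₁) {m : ℕ} {ε : ℝ} (hε : 0 < ε)
    (hm : 22 * Real.log n * ε⁻¹ ≤ m) (x : Vec n) :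
    ∫⁻ s : Fin m → Ξ, ENNReal.ofReal ‖hess (batch f s) x - hess (objective P f) x‖
        ∂(Measure.pi fun _ => P)
      ≤ ENNReal.ofReal (Real.sqrt ε * (1 + K₀ + K₁ * ‖gradient (objective P f) x‖)) := by
  obtain ⟨h1, h2, h3, h4⟩ := hvar x
  have hZ : Measurable fun ξ => hess (fun y => f y ξ) x :=
    (measurable_hess_uncurry hf hd).comp measurable_prodMk_left
  have hfin : Module.finrank ℝ (Vec n) = n := by simp
  have hs : 0 < Real.sqrt ε := Real.sqrt_pos.2 hε
  simp only [hess_batch hd]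
  refine lintegral_opNorm_batch_sub_le (by rwa [hfin]) P hZ (fun ξ => hess_isSymmetric (hd ξ) x) h1
    (hess_isSymmetric hF x) h2 h3 h4 hε (by rwa [hfin]) (by positivity) ?_
  set G := ‖gradient (objective P f) x‖
  have hG : 0 ≤ G := norm_nonneg _
  rw [mul_pow, Real.sq_sqrt hε.le]
  refine mul_le_mul_of_nonneg_left ?_ hε.le
  have : 0 ≤ K₁ * G := by positivity
  nlinarith [mul_nonneg hK₀ this]

end Oracle

/-! ### Law of the fresh samples and deterministic growth along a run. -/

section Run

variable [MeasurableSpace Ξ] [mΩ : MeasurableSpace Ω] {P : Measure Ξ}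
  {f : Vec n → Ξ → ℝ} {μ : Measure Ω} {ℱ : Filtration ℕ mΩ} {x₀ : Vec n}
  {Δ : ℝ} {T m₁ m₂ : ℕ} {S₁ : ℕ → Fin m₁ → Ω → Ξ} {S₂ : ℕ → Fin m₂ → Ω → Ξ}
  {V : ℕ → Ω → Matrix (Fin n) (Fin k) ℝ} {x d : ℕ → Ω → Vec n}

theorem map_prodMk_eq_of_indep [IsProbabilityMeasure μ] {m : ℕ} {X : Ω → Vec n} {S : Fin m → Ω → Ξ} (hX : Measurable X)
    (hS : ∀ i, Measurable (S i)) (hlaw : ∀ i, μ.map (S i) = P)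
    (hind : iIndepFun S μ) (hfresh : IndepFun X (fun ω i => S i ω) μ) :
    μ.map (fun ω => (X ω, fun i => S i ω)) = (μ.map X).prod (Measure.pi fun _ => P) := by
  have hSm : Measurable fun ω i => S i ω := measurable_pi_lambda _ hS
  rw [(indepFun_iff_map_prod_eq_prod_map_map hX.aemeasurable hSm.aemeasurable).1 hfresh,
    (iIndepFun_iff_map_fun_eq_pi_map fun i => (hS i).aemeasurable).1 hind]
  simp only [hlaw]

theorem IsRun.measurable_iterate (h : IsRun P f μ ℱ x₀ Δ T m₁ m₂ S₁ S₂ V x d) {t : ℕ}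
    (ht : t ≤ T) : Measurable (x t) := (h.iterate_meas t ht).mono (ℱ.le t) le_rfl

theorem IsRun.map_gradient_sample [IsProbabilityMeasure μ]
    (h : IsRun P f μ ℱ x₀ Δ T m₁ m₂ S₁ S₂ V x d) {t : ℕ}
    (ht : t < T) : μ.map (fun ω => (x t ω, fun i => S₁ t i ω))
      = (μ.map (x t)).prod (Measure.pi fun _ => P) := by
  refine map_prodMk_eq_of_indep (h.measurable_iterate ht.le)
    (fun i => (h.sample₁_meas t ht i).mono (ℱ.le _) le_rfl) (h.sample₁_law t ht)
    (iIndepFun.precomp (g := Sum.inl) Sum.inl_injective (h.sample_indep t ht)) ?_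
  rw [IndepFun_iff_Indep]
  refine (indep_of_indep_of_le_left (indep_of_indep_of_le_right (h.sample_fresh t ht)
    (h.iterate_meas t ht.le).comap_le) ?_).symm
  exact (measurable_fst.comp (comap_measurable (fun ω => ((fun i => S₁ t i ω, fun j => S₂ t j ω) :
    (Fin m₁ → Ξ) × (Fin m₂ → Ξ))))).comap_le

theorem IsRun.map_hess_sample [IsProbabilityMeasure μ]
    (h : IsRun P f μ ℱ x₀ Δ T m₁ m₂ S₁ S₂ V x d) {t : ℕ}
    (ht : t < T) : μ.map (fun ω => (x t ω, fun i => S₂ t i ω))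
      = (μ.map (x t)).prod (Measure.pi fun _ => P) := by
  refine map_prodMk_eq_of_indep (h.measurable_iterate ht.le)
    (fun i => (h.sample₂_meas t ht i).mono (ℱ.le _) le_rfl) (h.sample₂_law t ht)
    (iIndepFun.precomp (g := Sum.inr) Sum.inr_injective (h.sample_indep t ht)) ?_
  rw [IndepFun_iff_Indep]
  refine (indep_of_indep_of_le_left (indep_of_indep_of_le_right (h.sample_fresh t ht)
    (h.iterate_meas t ht.le).comap_le) ?_).symm
  exact (measurable_snd.comp (comap_measurable (fun ω => ((fun i => S₁ t i ω, fun j => S₂ t j ω) :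
    (Fin m₁ → Ξ) × (Fin m₂ → Ξ))))).comap_le

/-- Adding `L₀ Δ` turns the one-step bound into pure doubling. -/
theorem IsRun.norm_gradient_le (h : IsRun P f μ ℱ x₀ Δ T m₁ m₂ S₁ S₂ V x d) {L₀ L₁ : ℝ}
    (hL₀ : 0 ≤ L₀) (hL₁ : 0 ≤ L₁) (hΔ : L₁ * Δ ≤ 1)
    (hF : GeneralizedSmooth (objective P f) L₀ L₁) {t : ℕ} (ht : t ≤ T) (ω : Ω) :
    ‖gradient (objective P f) (x t ω)‖ + L₀ * Δ
      ≤ 2 ^ t * (‖gradient (objective P f) x₀‖ + L₀ * Δ) := by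
  induction t with
  | zero => rw [h.start ω]; simp
  | succ t ih =>
    have h1 := hF.norm_gradient_le_add hL₀ hL₁ hΔ (x := x t ω) (h.step t ht ω).1
    rw [h.update t ht ω, pow_succ]
    have := ih (by omega)
    linarith

end Run

/-! ### A uniform random index as an average over iterations. -/

section UniformIndex

theorem uniformOn_Iio_eq (T : ℕ) :
    uniformOn (Set.Iio T) = (T : ENNReal)⁻¹ • ∑ t ∈ Finset.range T, Measure.dirac t := by
  refine Measure.ext_of_singleton fun s => ?_
  rw [uniformOn, cond_apply measurableSet_Iio, Measure.smul_apply, Measure.finsetSum_apply]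
  have h1 : Measure.count (Set.Iio T) = (T : ENNReal) := by
    rw [← Finset.coe_Iio, Measure.count_apply_finset]
    simp
  rw [h1, smul_eq_mul]
  congr 1
  simp only [Measure.dirac_apply, Set.indicator_apply, Set.mem_singleton_iff, Pi.one_apply]
  rw [Finset.sum_ite_eq']
  by_cases hs : s < T
  · have : Set.Iio T ∩ {s} = {s} := by ext; simp; omega
    simp [this, hs]
  · have : Set.Iio T ∩ {s} = ∅ := by ext; simp; omega
    simp [this, hs]

theorem integrable_withUniformIndex [MeasurableSpace Ω] {μ : Measure Ω} [IsProbabilityMeasure μ]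
    {T : ℕ} (hT : 0 < T) {u : ℕ → Ω → ℝ} (hu : ∀ t < T, Integrable (u t) μ) :
    Integrable (fun p : ℕ × Ω => u p.1 p.2) (withUniformIndex T μ) ∧
      ∫ p : ℕ × Ω, u p.1 p.2 ∂(withUniformIndex T μ)
        = (T : ℝ)⁻¹ * ∑ t ∈ Finset.range T, ∫ ω, u t ω ∂μ := by
  have hsum : ∀ s : Finset ℕ, (∑ t ∈ s, Measure.dirac t).prod μ
      = ∑ t ∈ s, μ.map (Prod.mk t) := fun s => by
    classical
    induction s using Finset.induction_on with
    | empty => simp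
    | insert a s ha ih =>
      rw [Finset.sum_insert ha, Finset.sum_insert ha, Measure.add_prod, ih, Measure.dirac_prod]
  have e : withUniformIndex T μ
      = (T : ENNReal)⁻¹ • ∑ t ∈ Finset.range T, μ.map (Prod.mk t) := by
    rw [withUniformIndex, uniformOn_Iio_eq, Measure.prod_smul_left, hsum]
  have hemb : ∀ t : ℕ, MeasurableEmbedding (Prod.mk t : Ω → ℕ × Ω) :=
    fun t => measurableEmbedding_prodMk_left t
  have hi : ∀ t ∈ Finset.range T, Integrable (fun p : ℕ × Ω => u p.1 p.2) (μ.map (Prod.mk t)) :=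
    fun t ht => (hemb t).integrable_map_iff.2 (hu t (Finset.mem_range.1 ht))
  rw [e]
  constructor
  · refine Integrable.smul_measure ?_ (by simp [hT.ne'])
    exact integrable_finsetSum_measure.2 hi
  · rw [integral_smul_measure, integral_finsetSum_measure hi]
    simp [(hemb _).integral_map]

end UniformIndex

/-! ### Summation over the run and the resulting arithmetic. -/

section Averaging

/-- Summing the expected decrease of the objective over the iterations. -/
theorem sum_integral_le_of_decrease [MeasurableSpace Ω] {μ : Measure Ω} [IsProbabilityMeasure μ]
    {T : ℕ} {Δ D G₀ G₁ K₀ K₁ M₀ M₁ : ℝ} (hΔ : 0 ≤ Δ)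
    {F : ℕ → Ω → ℝ} {G eg eH U : ℕ → Ω → ℝ} (hF : ∀ ω, F 0 ω - F T ω ≤ D)
    (hG : ∀ t < T, Integrable (G t) μ) (hU : ∀ t < T, Integrable (U t) μ)
    (heg : ∀ t < T, Integrable (eg t) μ) (heH : ∀ t < T, Integrable (eH t) μ)
    (hegle : ∀ t < T, ∫ ω, eg t ω ∂μ ≤ Δ ^ 2 * (1 + G₀ + G₁ * ∫ ω, G t ω ∂μ))
    (heHle : ∀ t < T, ∫ ω, eH t ω ∂μ ≤ Δ * (1 + K₀ + K₁ * ∫ ω, G t ω ∂μ))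
    (hstep : ∀ t < T, ∀ᵐ ω ∂μ, U t ω ≤ F t ω - F (t + 1) ω
      + 2 * (Δ * eg t ω + Δ ^ 2 * eH t ω + Δ ^ 3 * (M₀ + M₁ * G t ω))) :
    ∑ t ∈ Finset.range T, ∫ ω, U t ω ∂μ ≤ D + Δ ^ 3 * (T * (2 * (2 + G₀ + K₀ + M₀))
      + 2 * (G₁ + K₁ + M₁) * ∑ t ∈ Finset.range T, ∫ ω, G t ω ∂μ) := by
  set Q : ℕ → Ω → ℝ := fun t ω =>
    2 * (Δ * eg t ω + Δ ^ 2 * eH t ω + Δ ^ 3 * (M₀ + M₁ * G t ω)) with hQ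
  have i1 : ∀ t < T, Integrable (fun ω => Δ * eg t ω + Δ ^ 2 * eH t ω) μ := fun t ht =>
    ((heg t ht).const_mul _).add ((heH t ht).const_mul _)
  have i2 : ∀ t < T, Integrable (fun ω => M₀ + M₁ * G t ω) μ := fun t ht =>
    (integrable_const _).add ((hG t ht).const_mul _)
  have hQi : ∀ t < T, Integrable (Q t) μ := fun t ht =>
    ((i1 t ht).add ((i2 t ht).const_mul _)).const_mul 2
  -- All three errors scale alike: `Δ · Δ²`, `Δ² · Δ` and `Δ³`.
  have hQle : ∀ t < T, ∫ ω, Q t ω ∂μ ≤ Δ ^ 3 * (2 * (2 + G₀ + K₀ + M₀)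
      + 2 * (G₁ + K₁ + M₁) * ∫ ω, G t ω ∂μ) := fun t ht => by
    have e : ∫ ω, Q t ω ∂μ = 2 * (Δ * ∫ ω, eg t ω ∂μ + Δ ^ 2 * ∫ ω, eH t ω ∂μ
        + Δ ^ 3 * (M₀ + M₁ * ∫ ω, G t ω ∂μ)) := by
      rw [hQ]
      simp only
      rw [integral_const_mul, integral_add (i1 t ht) ((i2 t ht).const_mul _),
        integral_add ((heg t ht).const_mul _) ((heH t ht).const_mul _), integral_const_mul,
        integral_const_mul, integral_const_mul,
        integral_add (integrable_const _) ((hG t ht).const_mul _), integral_const_mul]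
      simp
    have h1 := mul_le_mul_of_nonneg_left (hegle t ht) hΔ
    have h2 := mul_le_mul_of_nonneg_left (heHle t ht) (sq_nonneg Δ)
    rw [e]
    linarith
  have hall : ∀ᵐ ω ∂μ, ∀ t ∈ Finset.range T, U t ω ≤ F t ω - F (t + 1) ω + Q t ω := by
    rw [Finset.eventually_all]
    exact fun t ht => hstep t (Finset.mem_range.1 ht)
  -- The telescoping is done pointwise before integrating, so no integrability of `F` along the run
  -- is required.
  calc ∑ t ∈ Finset.range T, ∫ ω, U t ω ∂μ = ∫ ω, ∑ t ∈ Finset.range T, U t ω ∂μ :=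
        (integral_finsetSum _ fun t ht => hU t (Finset.mem_range.1 ht)).symm
    _ ≤ ∫ ω, (D + ∑ t ∈ Finset.range T, Q t ω) ∂μ := by
        refine integral_mono_ae
          (integrable_finsetSum _ fun t ht => hU t (Finset.mem_range.1 ht))
          ((integrable_const _).add
            (integrable_finsetSum _ fun t ht => hQi t (Finset.mem_range.1 ht))) ?_
        filter_upwards [hall] with ω hω
        have h1 := Finset.sum_le_sum hω
        rw [Finset.sum_add_distrib, Finset.sum_range_sub'] at h1
        linarith [hF ω]
    _ = D + ∑ t ∈ Finset.range T, ∫ ω, Q t ω ∂μ := by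
        rw [integral_add (integrable_const _)
          (integrable_finsetSum _ fun t ht => hQi t (Finset.mem_range.1 ht)),
          integral_finsetSum _ fun t ht => hQi t (Finset.mem_range.1 ht)]
        simp
    _ ≤ D + ∑ t ∈ Finset.range T, Δ ^ 3 * (2 * (2 + G₀ + K₀ + M₀)
      + 2 * (G₁ + K₁ + M₁) * ∫ ω, G t ω ∂μ) :=
        add_le_add le_rfl (Finset.sum_le_sum fun t ht => hQle t (Finset.mem_range.1 ht))
    _ = _ := by
        rw [← Finset.mul_sum, Finset.sum_add_distrib, Finset.sum_const, Finset.card_range,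
          nsmul_eq_mul, ← Finset.mul_sum]

/-- Here `s` stands for the summed expected gradient norms at the new points, `s'` for those at the
old points and `l` for the summed negative curvatures. Since `β Δ³ ≤ Δ / 4`, half of the left side
of `h1` absorbs `β Δ³ s`, giving `Δ s ≤ 4W`; inserted in `h2`, this gives `Δ² l ≤ 4W`. Finally `1 /
T ≤ Δ³ / a`. -/
theorem average_bounds {T a b Δ D α β g s s' l : ℝ} (ha : 0 < a) (hD : 0 ≤ D) (hα : 0 ≤ α)
    (hβ : 0 ≤ β) (hg : 0 ≤ g) (hΔ : 0 < Δ) (hΔ1 : Δ ≤ 1) (hβΔ : β * Δ ^ 2 ≤ 1 / 4)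
    (haT : a ≤ T * Δ ^ 3) (hTb : T * Δ ^ 3 ≤ b) (hs : s' ≤ g + s)
    (h1 : 1 / 2 * Δ * s ≤ D + Δ ^ 3 * (T * α + β * s'))
    (h2 : 1 / 2 * Δ ^ 2 * l ≤ D + Δ ^ 3 * (T * α + β * s')) :
    T⁻¹ * s ≤ 4 * (D + α * b + g) / a * Δ ^ 2 ∧ T⁻¹ * l ≤ 4 * (D + α * b + g) / a * Δ := by
  have hT : 0 < T := by
    by_contra hT
    push Not at hT
    have := mul_nonpos_of_nonpos_of_nonneg hT (pow_nonneg hΔ.le 3)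
    linarith
  set W := D + α * b + g with hW
  have hb : 0 ≤ b := by linarith
  have hW0 : 0 ≤ W := by positivity
  have hβ3 : β * Δ ^ 3 ≤ 1 / 4 * Δ := by
    calc β * Δ ^ 3 = (β * Δ ^ 2) * Δ := by ring
      _ ≤ _ := by gcongr
  have hβ3' : 0 ≤ β * Δ ^ 3 := by positivity
  have e1 : Δ ^ 3 * (T * α + β * s') ≤ α * b + β * Δ ^ 3 * g + β * Δ ^ 3 * s := by
    have p1 : α * (T * Δ ^ 3) ≤ α * b := mul_le_mul_of_nonneg_left hTb hα
    have p2 : β * Δ ^ 3 * s' ≤ β * Δ ^ 3 * (g + s) := mul_le_mul_of_nonneg_left hs hβ3'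
    linarith
  have e2 : β * Δ ^ 3 * g ≤ g := by
    have : β * Δ ^ 3 ≤ 1 := by linarith
    exact mul_le_of_le_one_left hg this
  have e3 : Δ * s ≤ 4 * W := by
    by_cases hs0 : 0 ≤ s
    · have := mul_le_mul_of_nonneg_right hβ3 hs0
      linarith
    · push Not at hs0
      have := mul_neg_of_pos_of_neg hΔ hs0
      linarith
  have e4 : Δ ^ 2 * l ≤ 4 * W := by
    by_cases hs0 : 0 ≤ s
    · have := mul_le_mul_of_nonneg_right hβ3 hs0
      linarith
    · push Not at hs0
      have := mul_nonpos_of_nonneg_of_nonpos hβ3' hs0.le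
      linarith
  constructor
  · rw [inv_mul_le_iff₀ hT]
    have h3 : s ≤ 4 * W / Δ := by rw [le_div_iff₀ hΔ]; linarith
    refine h3.trans ?_
    have : 4 * W / Δ = 4 * W / a * Δ ^ 2 * (a * (Δ ^ 3)⁻¹) := by field_simp
    rw [this, mul_comm T]
    refine mul_le_mul_of_nonneg_left ?_ (by positivity)
    rw [← div_eq_mul_inv, div_le_iff₀ (by positivity)]
    exact haT
  · rw [inv_mul_le_iff₀ hT]
    have h3 : l ≤ 4 * W / Δ ^ 2 := by rw [le_div_iff₀ (by positivity)]; linarith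
    refine h3.trans ?_
    have : 4 * W / Δ ^ 2 = 4 * W / a * Δ * (a * (Δ ^ 3)⁻¹) := by field_simp
    rw [this, mul_comm T]
    refine mul_le_mul_of_nonneg_left ?_ (by positivity)
    rw [← div_eq_mul_inv, div_le_iff₀ (by positivity)]
    exact haT

end Averaging

/-! ### Integrability and averaged bounds along a run. -/

section RunBounds

variable [MeasurableSpace Ξ] [mΩ : MeasurableSpace Ω] {P : Measure Ξ}
  {f : Vec n → Ξ → ℝ} {μ : Measure Ω} {ℱ : Filtration ℕ mΩ} {x₀ : Vec n}
  {Δ : ℝ} {T m₁ m₂ : ℕ} {S₁ : ℕ → Fin m₁ → Ω → Ξ} {S₂ : ℕ → Fin m₂ → Ω → Ξ}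
  {V : ℕ → Ω → Matrix (Fin n) (Fin k) ℝ} {x d : ℕ → Ω → Vec n} {L₀ L₁ : ℝ}

theorem IsRun.integrable_norm_gradient [IsProbabilityMeasure μ]
    (h : IsRun P f μ ℱ x₀ Δ T m₁ m₂ S₁ S₂ V x d)
    (hL₀ : 0 ≤ L₀) (hL₁ : 0 ≤ L₁) (hΔ : L₁ * Δ ≤ 1) (hΔ0 : 0 ≤ Δ)
    (hF : GeneralizedSmooth (objective P f) L₀ L₁) (hF2 : TwiceDifferentiable (objective P f))
    {t : ℕ} (ht : t ≤ T) : Integrable (fun ω => ‖gradient (objective P f) (x t ω)‖) μ := by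
  refine Integrable.of_bound (C := 2 ^ t * (‖gradient (objective P f) x₀‖ + L₀ * Δ))
    (((continuous_gradient hF2).norm.measurable.comp
      (h.measurable_iterate ht)).aestronglyMeasurable) (Filter.Eventually.of_forall fun ω => ?_)
  have := h.norm_gradient_le hL₀ hL₁ hΔ hF ht ω
  have : 0 ≤ L₀ * Δ := by positivity
  rw [norm_norm]
  linarith

theorem IsRun.abs_lambdaMin_le (hn : 0 < n) (h : IsRun P f μ ℱ x₀ Δ T m₁ m₂ S₁ S₂ V x d)
    (hL₀ : 0 ≤ L₀) (hL₁ : 0 ≤ L₁)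
    (hF : GeneralizedSmooth (objective P f) L₀ L₁) (hF2 : TwiceDifferentiable (objective P f))
    {t : ℕ} (ht : t < T) (ω : Ω) :
    |lambdaMin (projected (V t ω) (hess (objective P f) (x (t + 1) ω)))|
      ≤ L₀ + L₁ * ‖gradient (objective P f) (x (t + 1) ω)‖ :=
  (TrustRegion.abs_lambdaMin_le hn (projected_isSelfAdjoint _ (hess_isSymmetric hF2 _))).trans
    ((norm_projected_le (h.basis_orthonormal t ht ω) _).trans (hF.norm_hess_le hL₀ hL₁ hF2 _))

theorem IsRun.integrable_lambdaMin [IsProbabilityMeasure μ] (hn : 0 < n)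
    (h : IsRun P f μ ℱ x₀ Δ T m₁ m₂ S₁ S₂ V x d)
    (hL₀ : 0 ≤ L₀) (hL₁ : 0 ≤ L₁) (hΔ : L₁ * Δ ≤ 1) (hΔ0 : 0 ≤ Δ)
    (hF : GeneralizedSmooth (objective P f) L₀ L₁) (hF2 : TwiceDifferentiable (objective P f))
    (hc : Continuous (hess (objective P f))) {t : ℕ} (ht : t < T) :
    Integrable (fun ω => lambdaMin (projected (V t ω) (hess (objective P f) (x (t + 1) ω)))) μ := by
  have hm : Measurable fun ω => projected (V t ω) (hess (objective P f) (x (t + 1) ω)) :=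
    measurable_projected (fun i j => (h.basis_meas t ht i j).mono (ℱ.le _) le_rfl)
      (hc.measurable.comp (h.measurable_iterate ht))
  have hsa : ∀ ω, IsSelfAdjoint (projected (V t ω) (hess (objective P f) (x (t + 1) ω))) :=
    fun ω => projected_isSelfAdjoint _ (hess_isSymmetric hF2 _)
  have hml : Measurable fun ω =>
      lambdaMin (projected (V t ω) (hess (objective P f) (x (t + 1) ω))) :=
    measurable_lambdaMin hn hm hsa
  have hb : Integrable (fun ω => L₀ + L₁ * ‖gradient (objective P f) (x (t + 1) ω)‖) μ :=
    (integrable_const _).add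
      ((h.integrable_norm_gradient hL₀ hL₁ hΔ hΔ0 hF hF2 ht).const_mul _)
  exact hb.mono' hml.aestronglyMeasurable (Filter.Eventually.of_forall fun ω =>
    h.abs_lambdaMin_le hn hL₀ hL₁ hF hF2 ht ω)

theorem IsRun.integral_gradient_error_le [IsProbabilityMeasure P] [IsProbabilityMeasure μ]
    (h : IsRun P f μ ℱ x₀ Δ T m₁ m₂ S₁ S₂ V x d)
    (hf : Measurable (Function.uncurry f)) (hd : ∀ ξ, Differentiable ℝ fun x => f x ξ)
    (hF2 : TwiceDifferentiable (objective P f))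
    {G₀ G₁ : ℝ} (hG₀ : 0 ≤ G₀) (hG₁ : 0 ≤ G₁) (hvar : BoundedGradientVariance P f G₀ G₁) {ε : ℝ}
    (hε : 0 < ε) (hm : (ε ^ 2)⁻¹ ≤ m₁) {t : ℕ} (ht : t < T)
    (hint : Integrable (fun ω => ‖gradient (objective P f) (x t ω)‖) μ) :
    Integrable (fun ω => ‖gradient (batch f fun i => S₁ t i ω) (x t ω)
        - gradient (objective P f) (x t ω)‖) μ ∧
      ∫ ω, ‖gradient (batch f fun i => S₁ t i ω) (x t ω) - gradient (objective P f) (x t ω)‖ ∂μ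
        ≤ ε * (1 + G₀ + G₁ * ∫ ω, ‖gradient (objective P f) (x t ω)‖ ∂μ) := by
  have hX := h.measurable_iterate ht.le
  have hS : Measurable fun ω i => S₁ t i ω :=
    measurable_pi_lambda _ fun i => (h.sample₁_meas t ht i).mono (ℱ.le _) le_rfl
  have hgm := (continuous_gradient hF2).measurable
  have hψ : Measurable fun p : Vec n × (Fin m₁ → Ξ) =>
      ‖gradient (batch f p.2) p.1 - gradient (objective P f) p.1‖ :=
    ((measurable_gradient_batch hf hd).sub (hgm.comp measurable_fst)).norm
  have hbm : Measurable fun y : Vec n => ε * (1 + G₀ + G₁ * ‖gradient (objective P f) y‖) :=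
    ((hgm.norm.const_mul G₁).const_add _).const_mul ε
  have hbi : Integrable (fun ω => ε * (1 + G₀ + G₁ * ‖gradient (objective P f) (x t ω)‖)) μ :=
    ((integrable_const _).add (hint.const_mul G₁)).const_mul ε
  have key := integrable_and_integral_le_of_lintegral_le (hψ.comp (hX.prodMk hS))
    (fun ω => norm_nonneg _) hbi (fun ω => by positivity)
    (lintegral_comp_le_of_indep hX hS (h.map_gradient_sample ht) hψ.ennreal_ofReal
      hbm.ennreal_ofReal (lintegral_gradient_error_le hf hd hG₀ hG₁ hvar hε hm))
  refine ⟨key.1, key.2.trans_eq ?_⟩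
  rw [integral_const_mul, integral_add (integrable_const _) (hint.const_mul G₁),
    integral_const_mul]
  simp

theorem IsRun.integral_hess_error_le [IsProbabilityMeasure P] [IsProbabilityMeasure μ]
    (hn : 2 ≤ n) (h : IsRun P f μ ℱ x₀ Δ T m₁ m₂ S₁ S₂ V x d)
    (hf : Measurable (Function.uncurry f)) (hd : ∀ ξ, TwiceDifferentiable fun x => f x ξ)
    (hF2 : TwiceDifferentiable (objective P f)) (hc : Continuous (hess (objective P f)))
    {K₀ K₁ : ℝ} (hK₀ : 0 ≤ K₀) (hK₁ : 0 ≤ K₁) (hvar : BoundedHessianVariance P f K₀ K₁) {ε : ℝ}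
    (hε : 0 < ε) (hm : 22 * Real.log n * ε⁻¹ ≤ m₂) {t : ℕ} (ht : t < T)
    (hint : Integrable (fun ω => ‖gradient (objective P f) (x t ω)‖) μ) :
    Integrable (fun ω => ‖hess (batch f fun i => S₂ t i ω) (x t ω)
        - hess (objective P f) (x t ω)‖) μ ∧
      ∫ ω, ‖hess (batch f fun i => S₂ t i ω) (x t ω) - hess (objective P f) (x t ω)‖ ∂μ
        ≤ Real.sqrt ε * (1 + K₀ + K₁ * ∫ ω, ‖gradient (objective P f) (x t ω)‖ ∂μ) := by
  have hX := h.measurable_iterate ht.le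
  have hS : Measurable fun ω i => S₂ t i ω :=
    measurable_pi_lambda _ fun i => (h.sample₂_meas t ht i).mono (ℱ.le _) le_rfl
  have hgm := (continuous_gradient hF2).measurable
  have hψ : Measurable fun p : Vec n × (Fin m₂ → Ξ) =>
      ‖hess (batch f p.2) p.1 - hess (objective P f) p.1‖ :=
    ((measurable_hess_batch hf hd).sub (hc.measurable.comp measurable_fst)).norm
  have hbm : Measurable fun y : Vec n =>
      Real.sqrt ε * (1 + K₀ + K₁ * ‖gradient (objective P f) y‖) :=
    ((hgm.norm.const_mul K₁).const_add _).const_mul _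
  have hbi : Integrable
      (fun ω => Real.sqrt ε * (1 + K₀ + K₁ * ‖gradient (objective P f) (x t ω)‖)) μ :=
    ((integrable_const _).add (hint.const_mul K₁)).const_mul _
  have key := integrable_and_integral_le_of_lintegral_le (hψ.comp (hX.prodMk hS))
    (fun ω => norm_nonneg _) hbi (fun ω => by positivity)
    (lintegral_comp_le_of_indep hX hS (h.map_hess_sample ht) hψ.ennreal_ofReal
      hbm.ennreal_ofReal (lintegral_hess_error_le hn hf hd hF2 hK₀ hK₁ hvar hε hm))
  refine ⟨key.1, key.2.trans_eq ?_⟩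
  rw [integral_const_mul, integral_add (integrable_const _) (hint.const_mul K₁),
    integral_const_mul]
  simp

/-- The averages of the gradient norms and of the negative curvatures along a run whose radius
is small. -/
theorem IsRun.average_bounds [IsProbabilityMeasure P] [IsProbabilityMeasure μ] (hn : 2 ≤ n)
    {ε G₀ G₁ δ M₀ M₁ K₀ K₁ C₀ C₁ D a b g : ℝ}
    (h : IsRun P f μ ℱ x₀ (Real.sqrt ε) T m₁ m₂ S₁ S₂ V x d)
    (hL₀ : 0 ≤ L₀) (hL₁ : 0 ≤ L₁) (hG₀ : 0 ≤ G₀) (hG₁ : 0 ≤ G₁)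
    (hδ : 0 < δ) (hM₀ : 0 ≤ M₀) (hM₁ : 0 ≤ M₁) (hK₀ : 0 ≤ K₀) (hK₁ : 0 ≤ K₁)
    (hC₀ : 0 ≤ C₀) (hC₁ : 0 ≤ C₁) (ha : 0 < a)
    (hf : Measurable (Function.uncurry f)) (hd : ∀ ξ, TwiceDifferentiable fun x => f x ξ)
    (hD : ∀ y, objective P f x₀ - objective P f y ≤ D)
    (hg : ‖gradient (objective P f) x₀‖ ≤ g)
    (hF : GeneralizedSmooth (objective P f) L₀ L₁) (hvar : BoundedGradientVariance P f G₀ G₁)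
    (hF2 : SecondOrderSmooth (objective P f) δ M₀ M₁) (hvar2 : BoundedHessianVariance P f K₀ K₁)
    (hin : SubspaceInexactness (objective P f) μ T V x d C₀ C₁)
    (hε : 0 < ε) (hεL : L₁ * Real.sqrt ε ≤ 1) (hε1 : Real.sqrt ε ≤ 1) (hεδ : Real.sqrt ε ≤ δ)
    (hεβ : 2 * (G₁ + K₁ + (M₁ + C₁)) * ε ≤ 1 / 4)
    (hm₁ : (ε ^ 2)⁻¹ ≤ m₁) (hm₂ : 22 * Real.log n * ε⁻¹ ≤ m₂)
    (haT : a ≤ T * Real.sqrt ε ^ 3) (hTb : T * Real.sqrt ε ^ 3 ≤ b) :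
    (T : ℝ)⁻¹ * ∑ t ∈ Finset.range T, ∫ ω, ‖gradient (objective P f) (x (t + 1) ω)‖ ∂μ
      ≤ 4 * (D + 2 * (2 + G₀ + K₀ + (M₀ + C₀)) * b + g) / a * ε ∧
    -(4 * (D + 2 * (2 + G₀ + K₀ + (M₀ + C₀)) * b + g) / a * Real.sqrt ε)
      ≤ (T : ℝ)⁻¹ * ∑ t ∈ Finset.range T,
        ∫ ω, lambdaMin (projected (V t ω) (hess (objective P f) (x (t + 1) ω))) ∂μ := by
  have hn0 : 0 < n := by omega
  have hD0 : 0 ≤ D := by simpa using hD x₀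
  set Δ := Real.sqrt ε with hΔdef
  have hΔ : 0 < Δ := Real.sqrt_pos.2 hε
  have hΔsq : Δ ^ 2 = ε := Real.sq_sqrt hε.le
  have hc := hF2.continuous_hess hδ
  have hGi : ∀ t ≤ T, Integrable (fun ω => ‖gradient (objective P f) (x t ω)‖) μ := fun t ht =>
    h.integrable_norm_gradient hL₀ hL₁ hεL hΔ.le hF hF2.1 ht
  have hΛi : ∀ t < T, Integrable
      (fun ω => lambdaMin (projected (V t ω) (hess (objective P f) (x (t + 1) ω)))) μ :=
    fun t ht => h.integrable_lambdaMin hn0 hL₀ hL₁ hεL hΔ.le hF hF2.1 hc ht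
  have heg := fun t (ht : t < T) => h.integral_gradient_error_le hf (fun ξ => (hd ξ).1) hF2.1
    hG₀ hG₁ hvar hε hm₁ ht (hGi t ht.le)
  have heH := fun t (ht : t < T) => h.integral_hess_error_le hn hf hd hF2.1 hc
    hK₀ hK₁ hvar2 hε hm₂ ht (hGi t ht.le)
  -- The subspace error has the same form as the Taylor error, so `C₀` and `C₁` are simply added to
  -- `M₀` and `M₁` below.
  have hdec := fun t (ht : t < T) (ω : Ω)
      (hω : ‖(hess (objective P f) (x t ω)
        - projected (V t ω) (hess (objective P f) (x t ω))) (d (t + 1) ω)‖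
      ≤ (C₀ + C₁ * ‖gradient (objective P f) (x t ω)‖) * ‖d (t + 1) ω‖ ^ 2) =>
    step_decrease hn0 hF2.1 hΔ (M := M₀ + M₁ * ‖gradient (objective P f) (x t ω)‖)
      (R := C₀ + C₁ * ‖gradient (objective P f) (x t ω)‖) (by positivity) (by positivity)
      (fun y hy => hF2.2 (x t ω) y (hy.trans hεδ)) (hess_batch_isSelfAdjoint hd _ _)
      (h.basis_orthonormal t ht ω) (h.step t ht ω) hω
  have hFT : ∀ ω, objective P f (x 0 ω) - objective P f (x T ω) ≤ D := fun ω => by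
    rw [h.start ω]; exact hD _
  have s1 := sum_integral_le_of_decrease (M₀ := M₀ + C₀) (M₁ := M₁ + C₁) (G₀ := G₀) (G₁ := G₁)
    (K₀ := K₀) (K₁ := K₁) hΔ.le (F := fun t ω => objective P f (x t ω)) hFT
    (U := fun t ω => 1 / 2 * Δ * ‖gradient (objective P f) (x (t + 1) ω)‖)
    (fun t ht => hGi t ht.le) (fun t ht => (hGi (t + 1) ht).const_mul _)
    (fun t ht => (heg t ht).1) (fun t ht => (heH t ht).1)
    (fun t ht => by rw [hΔsq]; exact (heg t ht).2) (fun t ht => (heH t ht).2)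
    (fun t ht => by
      filter_upwards [hin t ht] with ω hω
      have := (hdec t ht ω hω).1
      rw [← h.update t ht ω] at this
      refine this.trans_eq ?_
      ring)
  have s2 := sum_integral_le_of_decrease (M₀ := M₀ + C₀) (M₁ := M₁ + C₁) (G₀ := G₀) (G₁ := G₁)
    (K₀ := K₀) (K₁ := K₁) hΔ.le (F := fun t ω => objective P f (x t ω)) hFT
    (U := fun t ω => 1 / 2 * Δ ^ 2
      * -lambdaMin (projected (V t ω) (hess (objective P f) (x (t + 1) ω))))
    (fun t ht => hGi t ht.le) (fun t ht => (hΛi t ht).neg.const_mul _)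
    (fun t ht => (heg t ht).1) (fun t ht => (heH t ht).1)
    (fun t ht => by rw [hΔsq]; exact (heg t ht).2) (fun t ht => (heH t ht).2)
    (fun t ht => by
      filter_upwards [hin t ht] with ω hω
      have := (hdec t ht ω hω).2
      rw [← h.update t ht ω] at this
      refine this.trans_eq ?_
      ring)
  simp only [integral_const_mul, integral_neg, ← Finset.mul_sum, Finset.sum_neg_distrib] at s1 s2
  -- The errors involve gradients at `x_t`, the conclusion those at `x_{t+1}`: the two sums differ
  -- by their end terms, and the one at `T` is nonnegative.
  have hss : ∑ t ∈ Finset.range T, ∫ ω, ‖gradient (objective P f) (x t ω)‖ ∂μ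
      ≤ g + ∑ t ∈ Finset.range T, ∫ ω, ‖gradient (objective P f) (x (t + 1) ω)‖ ∂μ := by
    have e1 := Finset.sum_range_succ (fun t => ∫ ω, ‖gradient (objective P f) (x t ω)‖ ∂μ) T
    have e2 := Finset.sum_range_succ' (fun t => ∫ ω, ‖gradient (objective P f) (x t ω)‖ ∂μ) T
    have e3 : 0 ≤ ∫ ω, ‖gradient (objective P f) (x T ω)‖ ∂μ :=
      integral_nonneg fun _ => norm_nonneg _
    have e4 : ∫ ω, ‖gradient (objective P f) (x 0 ω)‖ ∂μ = ‖gradient (objective P f) x₀‖ := by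
      simp [h.start]
    linarith
  have fin := TrustRegion.average_bounds ha hD0 (α := 2 * (2 + G₀ + K₀ + (M₀ + C₀)))
    (β := 2 * (G₁ + K₁ + (M₁ + C₁))) (by positivity)
    (by positivity) ((norm_nonneg _).trans hg) hΔ hε1 (by rwa [hΔsq]) haT hTb hss s1 s2
  rw [hΔsq] at fin
  refine ⟨fin.1, ?_⟩
  linarith [fin.2]

end RunBounds

end TrustRegion

/-! ### Choice of the constant and the two ranges of `ε`. -/

theorem mainTheorem7
    (L₀ L₁ G₀ G₁ δ M₀ M₁ K₀ K₁ C₀ C₁ D a b : ℝ)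
    (hL₀ : 0 < L₀) (hL₁ : 0 ≤ L₁) (hG₀ : 0 ≤ G₀) (hG₁ : 0 ≤ G₁)
    (hδ : 0 < δ) (hM₀ : 0 < M₀) (hM₁ : 0 ≤ M₁) (hK₀ : 0 ≤ K₀) (hK₁ : 0 ≤ K₁)
    (hC₀ : 0 < C₀) (hC₁ : 0 < C₁) (ha : 0 < a) :
    ∃ C : ℝ, 0 < C ∧
      ∀ (n k : ℕ) (_ : 2 ≤ n)
        (Ξ : Type*) [MeasurableSpace Ξ] (P : Measure Ξ) [IsProbabilityMeasure P]
        (f : TrustRegion.Vec n → Ξ → ℝ) (_ : Measurable (Function.uncurry f))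
        (_ : ∀ x, Integrable (f x) P)
        (_ : ∀ ξ, TrustRegion.TwiceDifferentiable (fun x => f x ξ))
        (x₀ : TrustRegion.Vec n)
        (_ : BddBelow (Set.range (TrustRegion.objective P f)))
        (_ : TrustRegion.objective P f x₀ - ⨅ x, TrustRegion.objective P f x ≤ D)
        (_ : TrustRegion.GeneralizedSmooth (TrustRegion.objective P f) L₀ L₁)
        (_ : TrustRegion.BoundedGradientVariance P f G₀ G₁)
        (_ : TrustRegion.SecondOrderSmooth (TrustRegion.objective P f) δ M₀ M₁)
        (_ : TrustRegion.BoundedHessianVariance P f K₀ K₁)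
        (ε : ℝ) (_ : 0 < ε) (_ : ε < 3 / (5 * M₁ + 18 * G₁ + 24 * K₁ + 6 * C₁))
        (_ : L₁ ^ 2 * ε < 1)
        (T : ℕ) (_ : a * ε ^ (-(3 / 2) : ℝ) ≤ T) (_ : (T : ℝ) ≤ b * ε ^ (-(3 / 2) : ℝ))
        (m₁ m₂ : ℕ) (_ : m₁ = ⌈ε ^ (-2 : ℝ)⌉₊) (_ : m₂ = ⌈22 * Real.log n * ε⁻¹⌉₊)
        (Ω : Type*) [mΩ : MeasurableSpace Ω] (μ : Measure Ω) [IsProbabilityMeasure μ]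
        (ℱ : Filtration ℕ mΩ)
        (S₁ : ℕ → Fin m₁ → Ω → Ξ) (S₂ : ℕ → Fin m₂ → Ω → Ξ)
        (V : ℕ → Ω → Matrix (Fin n) (Fin k) ℝ) (x d : ℕ → Ω → TrustRegion.Vec n)
        (_ : TrustRegion.IsRun P f μ ℱ x₀ (Real.sqrt ε) T m₁ m₂ S₁ S₂ V x d)
        (_ : TrustRegion.SubspaceInexactness (TrustRegion.objective P f) μ T V x d C₀ C₁),
        (Integrable (fun p : ℕ × Ω => ‖gradient (TrustRegion.objective P f) (x (p.1 + 1) p.2)‖)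
            (TrustRegion.withUniformIndex T μ) ∧
          ∫ p : ℕ × Ω, ‖gradient (TrustRegion.objective P f) (x (p.1 + 1) p.2)‖
            ∂(TrustRegion.withUniformIndex T μ) ≤ C * ε) ∧
        (Integrable (fun p : ℕ × Ω => TrustRegion.lambdaMin (TrustRegion.projected (V p.1 p.2)
              (TrustRegion.hess (TrustRegion.objective P f) (x (p.1 + 1) p.2))))
            (TrustRegion.withUniformIndex T μ) ∧
          -(C * Real.sqrt ε) ≤ ∫ p : ℕ × Ω, TrustRegion.lambdaMin (TrustRegion.projected (V p.1 p.2)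
              (TrustRegion.hess (TrustRegion.objective P f) (x (p.1 + 1) p.2)))
            ∂(TrustRegion.withUniformIndex T μ)) := by
  -- Absolute values of `D` and `b` make the constant positive whatever the signs of these
  -- parameters.
  set D' : ℝ := |D| with hD'
  set g : ℝ := 4 * D' * L₁ + 4 * D' * L₀ + 1 with hgdef
  set β : ℝ := 2 * (G₁ + K₁ + (M₁ + C₁)) with hβdef
  have hβ : 0 < β := by positivity
  -- Below this threshold the step stays within the radius `δ`, `Δ ≤ 1`, and the gradient-dependent
  -- errors can be absorbed.
  set ε₀ : ℝ := min (δ ^ 2) (min 1 (1 / (4 * β))) with hε₀def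
  have hε₀ : 0 < ε₀ := by positivity
  -- Above the threshold, `N` bounds the number of iterations and `R` every gradient norm after the
  -- first step; `√(1 / (2 C₁))` is an upper bound for `Δ`.
  set N : ℕ := ⌈|b| * ε₀ ^ (-(3 / 2) : ℝ)⌉₊ with hN
  set R : ℝ := 2 ^ N * (g + L₀ * Real.sqrt (1 / (2 * C₁))) with hR
  have hg0 : 0 ≤ g := by positivity
  have hR0 : 0 ≤ R := by positivity
  set W : ℝ := 4 * (D' + 2 * (2 + G₀ + K₀ + (M₀ + C₀)) * |b| + g) / a with hW
  have hW0 : 0 ≤ W := by positivity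
  refine ⟨W + R / ε₀ + (L₀ + L₁ * R) / Real.sqrt ε₀ + 1, by positivity, ?_⟩
  intro n k hn Ξ _ P _ f hf _ hd x₀ hbdd hΔF hF hvar hF2 hvar2 ε hε hε3 hεL T haT hTb m₁ m₂ hm₁ hm₂
    Ω mΩ μ _ ℱ S₁ S₂ V x d h hin
  have hn0 : 0 < n := by omega
  set Δ := Real.sqrt ε with hΔdef
  have hΔ : 0 < Δ := Real.sqrt_pos.2 hε
  have hΔsq : Δ ^ 2 = ε := Real.sq_sqrt hε.le
  have hΔ3 : ε ^ (-(3 / 2) : ℝ) = (Δ ^ 3)⁻¹ := by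
    rw [hΔdef, Real.sqrt_eq_rpow, ← Real.rpow_natCast, ← Real.rpow_mul hε.le,
      ← Real.rpow_neg hε.le]
    norm_num
  have hLΔ : L₁ * Δ ≤ 1 := by
    refine le_of_pow_le_pow_left₀ two_ne_zero zero_le_one ?_
    rw [mul_pow, hΔsq]
    linarith
  have hD : ∀ y, TrustRegion.objective P f x₀ - TrustRegion.objective P f y ≤ D' := fun y => by
    have := ciInf_le hbdd y
    linarith [le_abs_self D]
  have hgx : ‖gradient (TrustRegion.objective P f) x₀‖ ≤ g := hF.norm_gradient_le hL₀ hL₁ hD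
  have haT' : a ≤ T * Δ ^ 3 := by
    rwa [hΔ3, ← div_eq_mul_inv, div_le_iff₀ (by positivity)] at haT
  have hTb' : (T : ℝ) * Δ ^ 3 ≤ |b| := by
    rw [hΔ3, ← div_eq_mul_inv, le_div_iff₀ (by positivity)] at hTb
    exact hTb.trans (le_abs_self b)
  have hT : 0 < T := by
    rcases Nat.eq_zero_or_pos T with h0 | h0
    · rw [h0] at haT'; simp at haT'; linarith
    · exact h0
  have hT0 : (0 : ℝ) < T := by exact_mod_cast hT
  have hc := hF2.continuous_hess hδ
  have hGi : ∀ t < T, Integrable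
      (fun ω => ‖gradient (TrustRegion.objective P f) (x (t + 1) ω)‖) μ := fun t ht =>
    h.integrable_norm_gradient hL₀.le hL₁ hLΔ hΔ.le hF hF2.1 ht
  have hΛi : ∀ t < T, Integrable (fun ω => TrustRegion.lambdaMin (TrustRegion.projected (V t ω)
      (TrustRegion.hess (TrustRegion.objective P f) (x (t + 1) ω)))) μ :=
    fun t ht => h.integrable_lambdaMin hn0 hL₀.le hL₁ hLΔ hΔ.le hF hF2.1 hc ht
  obtain ⟨iG, eG⟩ := TrustRegion.integrable_withUniformIndex hT hGi
  obtain ⟨iΛ, eΛ⟩ := TrustRegion.integrable_withUniformIndex hT hΛi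
  rw [eG, eΛ]
  suffices hmain : (T : ℝ)⁻¹ * ∑ t ∈ Finset.range T,
        ∫ ω, ‖gradient (TrustRegion.objective P f) (x (t + 1) ω)‖ ∂μ
        ≤ (W + R / ε₀ + (L₀ + L₁ * R) / Real.sqrt ε₀ + 1) * ε ∧
      -((W + R / ε₀ + (L₀ + L₁ * R) / Real.sqrt ε₀ + 1) * Δ) ≤ (T : ℝ)⁻¹ * ∑ t ∈ Finset.range T,
        ∫ ω, TrustRegion.lambdaMin (TrustRegion.projected (V t ω)
          (TrustRegion.hess (TrustRegion.objective P f) (x (t + 1) ω))) ∂μ from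
    ⟨⟨iG, hmain.1⟩, iΛ, hmain.2⟩
  have c1 : 0 ≤ R / ε₀ := by positivity
  have c2 : 0 ≤ (L₀ + L₁ * R) / Real.sqrt ε₀ := by positivity
  rcases le_or_gt ε ε₀ with hsmall | hlarge
  · have hεδ : Δ ≤ δ := by
      refine le_of_pow_le_pow_left₀ two_ne_zero hδ.le ?_
      rw [hΔsq]
      exact hsmall.trans (min_le_left _ _)
    have hε1 : Δ ≤ 1 := by
      rw [hΔdef, Real.sqrt_le_one]
      exact hsmall.trans ((min_le_right _ _).trans (min_le_left _ _))
    have hεβ : β * ε ≤ 1 / 4 := by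
      have : ε ≤ 1 / (4 * β) := hsmall.trans ((min_le_right _ _).trans (min_le_right _ _))
      rw [le_div_iff₀ (by positivity)] at this
      linarith
    have hm₁' : (ε ^ 2)⁻¹ ≤ m₁ := by
      rw [hm₁]
      refine le_trans (le_of_eq ?_) (Nat.le_ceil _)
      rw [Real.rpow_neg hε.le]
      norm_num
    have hm₂' : 22 * Real.log n * ε⁻¹ ≤ m₂ := by
      rw [hm₂]
      exact Nat.le_ceil _
    have key := h.average_bounds hn hL₀.le hL₁ hG₀ hG₁ hδ hM₀.le hM₁ hK₀ hK₁ hC₀.le hC₁.le ha hf hd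
      hD hgx hF hvar hF2 hvar2 hin hε hLΔ hε1 hεδ hεβ hm₁' hm₂' haT' hTb'
    have k1 : W * ε ≤ (W + R / ε₀ + (L₀ + L₁ * R) / Real.sqrt ε₀ + 1) * ε :=
      mul_le_mul_of_nonneg_right (by linarith) hε.le
    have k2 : W * Δ ≤ (W + R / ε₀ + (L₀ + L₁ * R) / Real.sqrt ε₀ + 1) * Δ :=
      mul_le_mul_of_nonneg_right (by linarith) hΔ.le
    exact ⟨key.1.trans k1, (neg_le_neg k2).trans key.2⟩
  · have hTN : T ≤ N := by
      have h1 : (T : ℝ) ≤ N := by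
        refine hTb.trans (le_trans ?_ (Nat.le_ceil _))
        refine mul_le_mul (le_abs_self b) ?_ (by positivity) (abs_nonneg b)
        exact Real.rpow_le_rpow_of_nonpos hε₀ hlarge.le (by norm_num)
      exact_mod_cast h1
    -- The assumed upper bound on `ε` with `C₁ > 0` caps the radius independently of the problem.
    have hεC : ε ≤ 1 / (2 * C₁) := by
      refine hε3.le.trans ?_
      rw [div_le_div_iff₀ (by positivity) (by positivity)]
      linarith
    have hGR : ∀ t < T, ∀ ω, ‖gradient (TrustRegion.objective P f) (x (t + 1) ω)‖ ≤ R := by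
      intro t ht ω
      have h1 := h.norm_gradient_le hL₀.le hL₁ hLΔ hF (t := t + 1) ht ω
      have h2 : Δ ≤ Real.sqrt (1 / (2 * C₁)) := Real.sqrt_le_sqrt hεC
      have h3 : 0 ≤ L₀ * Δ := by positivity
      calc _ ≤ 2 ^ (t + 1) * (‖gradient (TrustRegion.objective P f) x₀‖ + L₀ * Δ) := by linarith
        _ ≤ 2 ^ N * (g + L₀ * Real.sqrt (1 / (2 * C₁))) := by
          gcongr
          · norm_num
          · omega
    constructor
    · have h1 : ∑ t ∈ Finset.range T,
          ∫ ω, ‖gradient (TrustRegion.objective P f) (x (t + 1) ω)‖ ∂μ ≤ T * R := by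
        refine (Finset.sum_le_card_nsmul _ _ R fun t ht => ?_).trans_eq (by simp)
        have ht' := Finset.mem_range.1 ht
        refine (integral_mono (hGi t ht') (integrable_const R) (hGR t ht')).trans_eq (by simp)
      -- Because `ε` exceeds `ε₀`, a constant bound is also a bound of order `ε`; below, likewise of
      -- order `√ε`.
      have h2 : R ≤ R / ε₀ * ε := by
        rw [div_mul_eq_mul_div, le_div_iff₀ hε₀]
        exact mul_le_mul_of_nonneg_left hlarge.le hR0
      calc _ ≤ (T : ℝ)⁻¹ * (T * R) := by gcongr
        _ = R := by field_simp
        _ ≤ R / ε₀ * ε := h2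
        _ ≤ _ := mul_le_mul_of_nonneg_right (by linarith) hε.le
    · have h1 : T * -(L₀ + L₁ * R) ≤ ∑ t ∈ Finset.range T,
          ∫ ω, TrustRegion.lambdaMin (TrustRegion.projected (V t ω)
            (TrustRegion.hess (TrustRegion.objective P f) (x (t + 1) ω))) ∂μ := by
        refine le_trans (le_of_eq (by simp; ring)) (Finset.card_nsmul_le_sum _ _ (-(L₀ + L₁ * R))
          fun t ht => ?_)
        have ht' := Finset.mem_range.1 ht
        refine le_trans (le_of_eq (by simp)) (integral_mono (integrable_const (-(L₀ + L₁ * R)))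
          (hΛi t ht') fun ω => ?_)
        have h2 := neg_le_of_abs_le (h.abs_lambdaMin_le hn0 hL₀.le hL₁ hF hF2.1 ht' ω)
        have h3 := mul_le_mul_of_nonneg_left (hGR t ht' ω) hL₁
        simp only
        linarith
      have h2 : L₀ + L₁ * R ≤ (L₀ + L₁ * R) / Real.sqrt ε₀ * Δ := by
        rw [div_mul_eq_mul_div, le_div_iff₀ (Real.sqrt_pos.2 hε₀)]
        exact mul_le_mul_of_nonneg_left (Real.sqrt_le_sqrt hlarge.le) (by positivity)
      calc _ ≤ -((L₀ + L₁ * R) / Real.sqrt ε₀ * Δ) :=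
            neg_le_neg (mul_le_mul_of_nonneg_right (by linarith) hΔ.le)
        _ ≤ -(L₀ + L₁ * R) := neg_le_neg h2
        _ = (T : ℝ)⁻¹ * (T * -(L₀ + L₁ * R)) := by field_simp
        _ ≤ _ := by gcongr
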